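/- Let $0<\beta<2$ with $\beta\ne 1$. In the real Hilbert space $L^2(0,1)$ consider the operator $Av=-(x^\beta v')'$ whose domain $D(A)$ consists of all $v\in C[0,1]$, differentiable in $(0,1)$, such that $x^\beta v'\in C[0,1]$, $(x^\beta v')'\in AC[0,1]$ (hence $Av\in L^2(0,1)$), $v(1)=0$ and, if $\beta<1$, also $v(0)=0$. Let $A_F$ be the Friedrichs extension of $A$, that is, the restriction of the adjoint $A^*$ to those $u\in D(A^*)$ for which there are $u_n\in D(A)$ with $u_n\to u$ in $L^2(0,1)$ and $(A(u_n-u_m),u_n-u_m)\to 0$ as $n,m\to\infty$. Then $A_F$ has a discrete spectrum: its spectrum consists of eigenvalues of finite multiplicity and has no finite accumulation point. Moreover, there are a sequence $(\lambda_n)$ of positive numbers with $\lambda_n\to\infty$, whose set of values is the spectrum of $A_F$, and functions $v_n\in D(A)$ such that: 1. $(v_n)$ is a complete orthonormal system in $L^2(0,1)$; 2. $v_n\in D(A_F)$ and $A_Fv_n=\lambda_n v_n$; in fact $-(x^\beta v_n')'=\lambda_n v_n$ holds pointwise in $(0,1)$; 3. $(v_n)$ is orthogonal in the energy space: for all $i,j$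 the function $x^\beta v_i'v_j'$ is integrable on $(0,1)$ and $$\int_0^1 x^\beta v_i'(x)\,v_j'(x)\,dx=\begin{cases}\lambda_i,& i=j,\\ 0,& i\ne j.\end{cases}$$ -/

import Mathlib

open Set Filter Topology MeasureTheory

noncomputable section

/-! ## Unbounded operators on a Hilbert space: spectrum and Friedrichs extension -/

namespace LinearPMap

section Spectrum

variable {𝕜 E : Type*} [RCLike 𝕜] [NormedAddCommGroup E] [InnerProductSpace 𝕜 E]

/-- The linear map `x ↦ T x - μ x` from the domain of `T` to `E`. -/
def shift (T : E →ₗ.[𝕜] E) (μ : 𝕜) : T.domain →ₗ[𝕜] E :=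
  T.toFun - μ • T.domain.subtype

/-- `μ` is in the resolvent set of `T` if `T - μ` maps the domain of `T` bijectively onto `E`, with
bounded inverse. -/
def resolventSet (T : E →ₗ.[𝕜] E) : Set 𝕜 :=
  {μ | Function.Bijective (T.shift μ) ∧ ∃ C : ℝ, ∀ x : T.domain, ‖(x : E)‖ ≤ C * ‖T.shift μ x‖}

/-- The spectrum of `T`. -/
def spectrum (T : E →ₗ.[𝕜] E) : Set 𝕜 := T.resolventSetᶜ

/-- The space of all `x` in the domain of `T` with `T x = μ x`. -/
def eigenspace (T : E →ₗ.[𝕜] E) (μ : 𝕜) : Submodule 𝕜 E :=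
  (LinearMap.ker (T.shift μ)).map T.domain.subtype

/-- The spectrum of `T` is discrete: it consists of eigenvalues of finite multiplicity and has no
(finite) accumulation point. -/
structure HasDiscreteSpectrum (T : E →ₗ.[𝕜] E) : Prop where
  eigenspace_ne_bot : ∀ μ ∈ T.spectrum, T.eigenspace μ ≠ ⊥
  finiteDimensional : ∀ μ ∈ T.spectrum, FiniteDimensional 𝕜 (T.eigenspace μ)
  not_accPt : ∀ μ : 𝕜, ¬ AccPt μ (𝓟 T.spectrum)

end Spectrum

section Friedrichs

variable {𝕜 E : Type*} [RCLike 𝕜] [NormedAddCommGroup E] [InnerProductSpace 𝕜 E]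

/-- The quadratic form `⟨T x, x⟩` on the domain of `T`. -/
def energy (T : E →ₗ.[𝕜] E) (x : T.domain) : ℝ := RCLike.re (inner 𝕜 (T x) (x : E))

theorem energy_add_sub (T : E →ₗ.[𝕜] E) (x y : T.domain) :
    T.energy (x + y) + T.energy (x - y) = 2 * T.energy x + 2 * T.energy y := by
  simp only [energy, LinearPMap.map_add, LinearPMap.map_sub, Submodule.coe_add,
    Submodule.coe_sub, inner_add_left, inner_add_right, inner_sub_left, inner_sub_right,
    _root_.map_add, _root_.map_sub]
  ring

theorem energy_smul (T : E →ₗ.[𝕜] E) (c : 𝕜) (x : T.domain) :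
    T.energy (c • x) = ‖c‖ ^ 2 * T.energy x := by
  have h : inner 𝕜 (T (c • x)) ((c • x : T.domain) : E)
      = ((‖c‖ ^ 2 : ℝ) : 𝕜) * inner 𝕜 (T x) (x : E) := by
    rw [LinearPMap.map_smul, Submodule.coe_smul, inner_smul_left, inner_smul_right, ← mul_assoc,
      RCLike.conj_mul]
    push_cast
    rfl
  rw [energy, h, RCLike.re_ofReal_mul, energy]

/-- The energy space of a symmetric positive operator `T`, as a subspace of `E` (the domain of the closure of
the quadratic form of `T`): all limits in `E` of sequences in the domain of `T` that are Cauchy with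
respect to the quadratic form of `T`. -/
def energySpace (T : E →ₗ.[𝕜] E) (hT : ∀ x : T.domain, 0 ≤ T.energy x) : Submodule 𝕜 E where
  carrier := {f | ∃ u : ℕ → T.domain, Tendsto (fun n => (u n : E)) atTop (𝓝 f) ∧
    Tendsto (fun p : ℕ × ℕ => T.energy (u p.1 - u p.2)) atTop (𝓝 0)}
  zero_mem' := ⟨fun _ => 0, by simp, by simp [energy]⟩
  add_mem' := by
    rintro f g ⟨u, hu, hu'⟩ ⟨v, hv, hv'⟩
    refine ⟨fun n => u n + v n, by simpa using hu.add hv, ?_⟩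
    have h := (hu'.const_mul 2).add (hv'.const_mul 2)
    simp only [mul_zero, add_zero] at h
    refine squeeze_zero (fun p => hT _) (fun p => ?_) h
    have e : u p.1 + v p.1 - (u p.2 + v p.2) = (u p.1 - u p.2) + (v p.1 - v p.2) := by abel
    rw [e, ← energy_add_sub]
    exact le_add_of_nonneg_right (hT _)
  smul_mem' := by
    rintro c f ⟨u, hu, hu'⟩
    refine ⟨fun n => c • u n, by simpa using hu.const_smul c, ?_⟩
    have h := hu'.const_mul (‖c‖ ^ 2)
    simpa only [mul_zero, ← energy_smul, smul_sub] using h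

/-- The Friedrichs extension of a densely defined, symmetric, positive operator `T`: the restriction of the
adjoint of `T` to the intersection of its domain with the energy space of `T`. -/
def friedrichsExtension [CompleteSpace E] (T : E →ₗ.[𝕜] E)
    (hT : ∀ x : T.domain, 0 ≤ T.energy x) : E →ₗ.[𝕜] E :=
  T.adjoint.domRestrict (T.energySpace hT)

end Friedrichs

end LinearPMap

/-! ## The degenerate operator `A v = -(x ^ β v')'` on the interval `(0, 1)` -/

namespace Degenerate

/-- The real Hilbert space `L²(0, 1)`. -/
abbrev L2 : Type := Lp ℝ 2 (volume.restrict (Ioo (0 : ℝ) 1))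

/-- The flux `x ^ β v'(x)`. -/
def flux (β : ℝ) (v : ℝ → ℝ) (x : ℝ) : ℝ := x ^ β * deriv v x

/-- The differential expression `A v = -(x ^ β v')'`. -/
def diffExpr (β : ℝ) (v : ℝ → ℝ) (x : ℝ) : ℝ := -deriv (flux β v) x

/-- The domain `D(A)`: `v` is continuous on `[0, 1]` and differentiable in `(0, 1)`, the flux
`x ^ β v'` extends continuously to `[0, 1]`, its derivative is absolutely continuous on `[0, 1]`
(so that `A v` is in `L²(0, 1)`), `v(1) = 0` and, if `β < 1`, also `v(0) = 0`. -/
structure InDomain (β : ℝ) (v : ℝ → ℝ) : Prop where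
  continuousOn : ContinuousOn v (Icc 0 1)
  differentiableAt : ∀ x ∈ Ioo (0 : ℝ) 1, DifferentiableAt ℝ v x
  flux_continuous : ∃ w : ℝ → ℝ, ContinuousOn w (Icc 0 1) ∧ EqOn w (flux β v) (Ioo 0 1)
  deriv_flux : ∃ g : ℝ → ℝ, AbsolutelyContinuousOnInterval g 0 1 ∧
    ∀ x ∈ Ioo (0 : ℝ) 1, HasDerivAt (flux β v) (g x) x
  right_boundary : v 1 = 0
  left_boundary : β < 1 → v 0 = 0

theorem flux_add {β : ℝ} {v₁ v₂ : ℝ → ℝ} {x : ℝ} (h₁ : DifferentiableAt ℝ v₁ x)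
    (h₂ : DifferentiableAt ℝ v₂ x) : flux β (v₁ + v₂) x = flux β v₁ x + flux β v₂ x := by
  simp only [flux, deriv_add h₁ h₂]; ring

theorem flux_smul {β : ℝ} {v : ℝ → ℝ} {x : ℝ} (c : ℝ) :
    flux β (c • v) x = c * flux β v x := by
  simp only [flux, deriv_const_smul_field c v, smul_eq_mul]; ring

namespace InDomain

variable {β : ℝ} {v v₁ v₂ : ℝ → ℝ}

theorem add_flux_eventuallyEq (h₁ : InDomain β v₁) (h₂ : InDomain β v₂) {x : ℝ}
    (hx : x ∈ Ioo (0 : ℝ) 1) : flux β (v₁ + v₂) =ᶠ[𝓝 x] flux β v₁ + flux β v₂ := by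
  filter_upwards [Ioo_mem_nhds hx.1 hx.2] with y hy
  exact flux_add (h₁.differentiableAt y hy) (h₂.differentiableAt y hy)

theorem zero : InDomain β (0 : ℝ → ℝ) := by
  have h : flux β (0 : ℝ → ℝ) = 0 := by
    ext x
    simpa using flux_smul (β := β) (v := 0) (x := x) 0
  refine ⟨continuousOn_const, fun x _ => differentiableAt_const (0 : ℝ),
    ⟨0, continuousOn_const, ?_⟩, ⟨fun _ => 0, ?_, ?_⟩, rfl, fun _ => rfl⟩
  · rw [h]; exact fun _ _ => rfl
  · exact contDiffOn_const.absolutelyContinuousOnInterval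
  · intro x _; rw [h]; exact hasDerivAt_const x (0 : ℝ)

theorem add (h₁ : InDomain β v₁) (h₂ : InDomain β v₂) : InDomain β (v₁ + v₂) := by
  obtain ⟨w₁, hw₁, hf₁⟩ := h₁.flux_continuous
  obtain ⟨w₂, hw₂, hf₂⟩ := h₂.flux_continuous
  obtain ⟨g₁, hg₁, hd₁⟩ := h₁.deriv_flux
  obtain ⟨g₂, hg₂, hd₂⟩ := h₂.deriv_flux
  refine ⟨h₁.continuousOn.add h₂.continuousOn,
    fun x hx => (h₁.differentiableAt x hx).add (h₂.differentiableAt x hx),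
    ⟨w₁ + w₂, hw₁.add hw₂, fun x hx => ?_⟩, ⟨g₁ + g₂, hg₁.add hg₂, fun x hx => ?_⟩, ?_,
    fun hβ => ?_⟩
  · rw [flux_add (h₁.differentiableAt x hx) (h₂.differentiableAt x hx), Pi.add_apply, hf₁ hx,
      hf₂ hx]
  · exact ((hd₁ x hx).add (hd₂ x hx)).congr_of_eventuallyEq (h₁.add_flux_eventuallyEq h₂ hx)
  · simp [h₁.right_boundary, h₂.right_boundary]
  · simp [h₁.left_boundary hβ, h₂.left_boundary hβ]

theorem smul (h : InDomain β v) (c : ℝ) : InDomain β (c • v) := by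
  obtain ⟨w, hw, hf⟩ := h.flux_continuous
  obtain ⟨g, hg, hd⟩ := h.deriv_flux
  have e : flux β (c • v) = fun x => c * flux β v x := funext fun x => flux_smul c
  refine ⟨h.continuousOn.const_smul c, fun x hx => (h.differentiableAt x hx).const_smul c,
    ⟨fun x => c * w x, hw.const_mul c, fun x hx => ?_⟩,
    ⟨fun x => c * g x, hg.const_mul c, fun x hx => ?_⟩, ?_, fun hβ => ?_⟩
  · simp only [e, hf hx]
  · rw [e]; exact (hd x hx).const_mul c
  · simp [h.right_boundary]
  · simp [h.left_boundary hβ]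

theorem diffExpr_add (h₁ : InDomain β v₁) (h₂ : InDomain β v₂) {x : ℝ}
    (hx : x ∈ Ioo (0 : ℝ) 1) :
    diffExpr β (v₁ + v₂) x = diffExpr β v₁ x + diffExpr β v₂ x := by
  obtain ⟨g₁, -, hd₁⟩ := h₁.deriv_flux
  obtain ⟨g₂, -, hd₂⟩ := h₂.deriv_flux
  rw [diffExpr, (h₁.add_flux_eventuallyEq h₂ hx).deriv_eq,
    ((hd₁ x hx).add (hd₂ x hx)).deriv, diffExpr, diffExpr, (hd₁ x hx).deriv, (hd₂ x hx).deriv]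
  ring

theorem diffExpr_smul (h : InDomain β v) (c : ℝ) {x : ℝ} (hx : x ∈ Ioo (0 : ℝ) 1) :
    diffExpr β (c • v) x = c * diffExpr β v x := by
  obtain ⟨g, -, hd⟩ := h.deriv_flux
  have e : flux β (c • v) = fun x => c * flux β v x := funext fun x => flux_smul c
  rw [diffExpr, e, ((hd x hx).const_mul c).deriv, diffExpr, (hd x hx).deriv]
  ring

end InDomain

/-- The graph of the operator `A` with domain `D(A)`, as a subspace of `L²(0, 1) × L²(0, 1)`. -/
def graph (β : ℝ) : Submodule ℝ (L2 × L2) where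
  carrier := {p | ∃ v : ℝ → ℝ, InDomain β v ∧ p.1 =ᵐ[volume.restrict (Ioo (0 : ℝ) 1)] v ∧
    p.2 =ᵐ[volume.restrict (Ioo (0 : ℝ) 1)] diffExpr β v}
  zero_mem' := by
    refine ⟨0, InDomain.zero, Lp.coeFn_zero _ _ _, (Lp.coeFn_zero _ _ _).trans ?_⟩
    filter_upwards [ae_restrict_mem measurableSet_Ioo] with x hx
    have := (InDomain.zero (β := β)).diffExpr_smul 0 hx
    rw [smul_zero, zero_mul] at this
    rw [this, Pi.zero_apply]
  add_mem' := by
    rintro p q ⟨v, hv, hp₁, hp₂⟩ ⟨u, hu, hq₁, hq₂⟩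
    refine ⟨v + u, hv.add hu, (Lp.coeFn_add _ _).trans (hp₁.add hq₁), ?_⟩
    filter_upwards [Lp.coeFn_add p.2 q.2, hp₂, hq₂, ae_restrict_mem measurableSet_Ioo]
      with x h h₁ h₂ hx
    rw [Prod.snd_add, h, Pi.add_apply, h₁, h₂, hv.diffExpr_add hu hx]
  smul_mem' := by
    rintro c p ⟨v, hv, hp₁, hp₂⟩
    refine ⟨c • v, hv.smul c, (Lp.coeFn_smul _ _).trans (hp₁.const_smul c), ?_⟩
    filter_upwards [Lp.coeFn_smul c p.2, hp₂, ae_restrict_mem measurableSet_Ioo] with x h h₁ hx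
    rw [Prod.smul_snd, h, Pi.smul_apply, h₁, hv.diffExpr_smul c hx, smul_eq_mul]

theorem graph_singleValued (β : ℝ) (p : L2 × L2) (hp : p ∈ graph β) (h0 : p.1 = 0) :
    p.2 = 0 := by
  obtain ⟨v, hv, h₁, h₂⟩ := hp
  have hv0 : EqOn v 0 (Ioo 0 1) := by
    refine Measure.eqOn_Ioo_of_ae_eq (μ := volume) ?_ (hv.continuousOn.mono Ioo_subset_Icc_self)
      continuousOn_const
    rw [h0] at h₁
    exact h₁.symm.trans (Lp.coeFn_zero _ _ _)
  have hf : EqOn (flux β v) (fun _ => 0) (Ioo 0 1) := by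
    intro x hx
    have : v =ᶠ[𝓝 x] fun _ => 0 := by
      filter_upwards [Ioo_mem_nhds hx.1 hx.2] with y hy using hv0 hy
    simp [flux, this.deriv_eq]
  refine Lp.ext (h₂.trans (EventuallyEq.trans ?_ (Lp.coeFn_zero _ _ _).symm))
  filter_upwards [ae_restrict_mem measurableSet_Ioo] with x hx
  have : flux β v =ᶠ[𝓝 x] fun _ => 0 := by
    filter_upwards [Ioo_mem_nhds hx.1 hx.2] with y hy using hf hy
  simp [diffExpr, this.deriv_eq]

/-- The operator `A v = -(x ^ β v')'` in `L²(0, 1)` with domain `D(A)`. -/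
def operator (β : ℝ) : L2 →ₗ.[ℝ] L2 := (graph β).toLinearPMap

theorem operator_graph (β : ℝ) : (operator β).graph = graph β :=
  Submodule.toLinearPMap_graph_eq _ (graph_singleValued β)

/-- If `β ≥ 1`, a function that is bounded near `0` has no positive flux at `0`. -/
theorem flux_zero_le {β : ℝ} (hβ : 1 ≤ β) {v w : ℝ → ℝ} (hv : ContinuousOn v (Icc 0 1))
    (hd : ∀ x ∈ Ioo (0 : ℝ) 1, DifferentiableAt ℝ v x) (hw : ContinuousOn w (Icc 0 1))
    (hf : EqOn w (flux β v) (Ioo 0 1)) : w 0 ≤ 0 := by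
  by_contra! hb
  set c := w 0 / 2 with hc
  have hcpos : 0 < c := by positivity
  have h0 : (0 : ℝ) ∈ Icc (0 : ℝ) 1 := ⟨le_rfl, zero_le_one⟩
  have hev : ∀ᶠ x in 𝓝[Icc 0 1] (0 : ℝ), c < w x :=
    (hw 0 h0).eventually (lt_mem_nhds (by linarith))
  obtain ⟨δ, hδ, hball⟩ := Metric.mem_nhdsWithin_iff.1 hev
  set a := min (δ / 2) (1 / 2) with ha
  have ha0 : 0 < a := by positivity
  have haδ : a ≤ δ / 2 := min_le_left _ _
  have ha1 : a ≤ 1 / 2 := min_le_right _ _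
  have hmono : MonotoneOn (fun x => v x - c * Real.log x) (Ioc 0 a) := by
    apply monotoneOn_of_deriv_nonneg (convex_Ioc 0 a)
    · refine (hv.mono fun x hx => ⟨hx.1.le, by linarith [hx.2]⟩).sub
        (ContinuousOn.const_mul (Real.continuousOn_log.mono fun x hx => ?_) c)
      exact ne_of_gt hx.1
    · rw [interior_Ioc]
      intro x hx
      exact ((hd x ⟨hx.1, by linarith [hx.2]⟩).sub
        ((Real.differentiableAt_log hx.1.ne').const_mul c)).differentiableWithinAt
    · rw [interior_Ioc]
      intro x hx
      have hx01 : x ∈ Ioo (0 : ℝ) 1 := ⟨hx.1, by linarith [hx.2]⟩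
      have hder : HasDerivAt (fun x => v x - c * Real.log x) (deriv v x - c * x⁻¹) x :=
        (hd x hx01).hasDerivAt.sub ((Real.hasDerivAt_log hx.1.ne').const_mul c)
      rw [hder.deriv]
      have hwx : c < w x := hball
        ⟨by rw [Metric.mem_ball, Real.dist_eq, sub_zero, abs_of_pos hx.1]; linarith [hx.2],
          hx.1.le, hx01.2.le⟩
      rw [hf hx01, flux] at hwx
      have hxb : 0 < x ^ β := Real.rpow_pos_of_pos hx.1 β
      have hle : x ^ β ≤ x := by
        simpa using Real.rpow_le_rpow_of_exponent_ge hx.1 hx01.2.le hβ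
      have hdv : 0 < deriv v x := by
        by_contra! hn
        nlinarith
      have : c ≤ x * deriv v x := by nlinarith
      rw [sub_nonneg, ← div_eq_mul_inv, div_le_iff₀ hx.1]
      linarith
  have hlim : Tendsto (fun x => v a - c * Real.log a + c * Real.log x) (𝓝[>] 0) atBot :=
    tendsto_atBot_add_const_left _ _
      (Real.tendsto_log_nhdsGT_zero.const_mul_atBot hcpos)
  have hvlim : Tendsto v (𝓝[>] 0) (𝓝 (v 0)) :=
    ((hv 0 h0).mono_of_mem_nhdsWithin (Icc_mem_nhdsGT zero_lt_one))
  have hbot : Tendsto v (𝓝[>] 0) atBot := by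
    refine tendsto_atBot_mono' _ ?_ hlim
    filter_upwards [Ioc_mem_nhdsGT ha0] with x hx
    have := hmono hx (right_mem_Ioc.2 ha0) hx.2
    simp only at this
    linarith
  exact not_tendsto_nhds_of_tendsto_atBot hbot _ hvlim

/-- The boundary term `v x ^ β v'` vanishes at `0` for every `v ∈ D(A)`. -/
theorem InDomain.flux_mul_zero {β : ℝ} {v w : ℝ → ℝ} (h : InDomain β v)
    (hw : ContinuousOn w (Icc 0 1)) (hf : EqOn w (flux β v) (Ioo 0 1)) : w 0 * v 0 = 0 := by
  rcases lt_or_ge β 1 with hβ | hβ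
  · rw [h.left_boundary hβ, mul_zero]
  · have h1 := flux_zero_le hβ h.continuousOn h.differentiableAt hw hf
    have h2 : (fun x => -w x) 0 ≤ 0 := by
      have hn := h.smul (-1)
      refine flux_zero_le hβ hn.continuousOn hn.differentiableAt hw.neg fun x hx => ?_
      rw [flux_smul, ← hf hx, Pi.neg_apply]
      ring
    have : w 0 = 0 := le_antisymm h1 (by simpa using h2)
    rw [this, zero_mul]

/-- The operator `A` is positive, so that its Friedrichs extension is defined. -/
theorem operator_energy_nonneg (β : ℝ) (f : (operator β).domain) : 0 ≤ (operator β).energy f := by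
  have hmem : ((f : L2), operator β f) ∈ graph β := by
    rw [← operator_graph]; exact LinearPMap.mem_graph _ f
  obtain ⟨v, hv, h₁, h₂⟩ := hmem
  obtain ⟨w, hw, hf⟩ := hv.flux_continuous
  obtain ⟨g, hg, hd⟩ := hv.deriv_flux
  have hgc : ContinuousOn g (Icc 0 1) := by
    have := hg.continuousOn
    rwa [uIcc_of_le zero_le_one] at this
  have hvg : ContinuousOn (fun x => g x * v x) (uIcc 0 1) := by
    rw [uIcc_of_le zero_le_one]; exact hgc.mul hv.continuousOn
  have hE : (operator β).energy f = -∫ x in (0 : ℝ)..1, g x * v x := by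
    rw [LinearPMap.energy, L2.inner_def, RCLike.re_to_real, intervalIntegral.integral_of_le
      zero_le_one, integral_Ioc_eq_integral_Ioo, ← integral_neg]
    refine integral_congr_ae ?_
    filter_upwards [h₁, h₂, ae_restrict_mem measurableSet_Ioo] with x hx₁ hx₂ hx
    rw [hx₁, hx₂, diffExpr, (hd x hx).deriv]
    simp [mul_comm]
  have hmono : MonotoneOn (fun x => w x * v x - ∫ t in (0 : ℝ)..x, g t * v t) (Icc 0 1) := by
    have hder : ∀ x ∈ Ioo (0 : ℝ) 1, HasDerivAt
        (fun x => w x * v x - ∫ t in (0 : ℝ)..x, g t * v t) (w x * deriv v x) x := by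
      intro x hx
      have hwd : HasDerivAt w (g x) x := by
        refine (hd x hx).congr_of_eventuallyEq ?_
        filter_upwards [Ioo_mem_nhds hx.1 hx.2] with y hy using hf hy
      have hnhds : Icc (0 : ℝ) 1 ∈ 𝓝 x := Icc_mem_nhds hx.1 hx.2
      rw [uIcc_of_le zero_le_one] at hvg
      have hI : HasDerivAt (fun x => ∫ t in (0 : ℝ)..x, g t * v t) (g x * v x) x := by
        refine intervalIntegral.integral_hasDerivAt_right ?_ ?_ (hvg.continuousAt hnhds)
        · refine (hvg.mono ?_).intervalIntegrable
          rw [uIcc_of_le hx.1.le]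
          exact Icc_subset_Icc_right hx.2.le
        · exact (hvg.mono Ioo_subset_Icc_self).stronglyMeasurableAtFilter isOpen_Ioo x hx
      have := (hwd.mul (hv.differentiableAt x hx).hasDerivAt).sub hI
      exact this.congr_deriv (by ring)
    apply monotoneOn_of_deriv_nonneg (convex_Icc 0 1)
    · refine (hw.mul hv.continuousOn).sub ?_
      have := intervalIntegral.continuousOn_primitive_interval (μ := volume)
        (hvg.integrableOn_compact isCompact_uIcc)
      rwa [uIcc_of_le zero_le_one] at this
    · rw [interior_Icc]
      exact fun x hx => (hder x hx).differentiableAt.differentiableWithinAt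
    · rw [interior_Icc]
      intro x hx
      rw [(hder x hx).deriv, hf hx, flux, mul_assoc]
      exact mul_nonneg (Real.rpow_nonneg hx.1.le β) (mul_self_nonneg _)
  have h01 := hmono (left_mem_Icc.2 zero_le_one) (right_mem_Icc.2 zero_le_one) zero_le_one
  simp only [intervalIntegral.integral_same, sub_zero, hv.right_boundary, mul_zero,
    hv.flux_mul_zero hw hf, zero_sub] at h01
  rwa [hE]

/-- The Friedrichs extension of the operator `A`. -/
def friedrichs (β : ℝ) : L2 →ₗ.[ℝ] L2 :=
  (operator β).friedrichsExtension (operator_energy_nonneg β)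

end Degenerate

end

/-!
Two solutions of the homogeneous equation `(x ^ β v')' = 0`, one subject to the boundary condition
at `0` and the other vanishing at `1`, give the Green's function
`leftSolution (min x y) * rightSolution (max x y)`. As `β < 2`, `rightSolution` is integrable, and
it dominates the Green's function in either variable. The solution operator is therefore a
symmetric Hilbert–Schmidt operator. It is a left inverse of `A`, and a right inverse on smooth
compactly supported data, which are dense; hence it is the bounded inverse of the Friedrichs
extension, and the spectral theorem for compact symmetric operators provides an orthonormal basis of
eigenvectors.

An eigenvector `f = lam * G f` is only known to be square integrable, whereas `D(A)` asks for
continuity up to `0`. On a set where `rightSolution` is large the integral operator is a contraction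
for a suitable weighted norm, which bounds `f`; then `G f` is continuous and, being absolutely
continuous after one more application of `G`, lies in `D(A)`. Finally, Green's formula
`∫ x ^ β u' v' = ∫ (A u) v` gives positivity of the eigenvalues and orthogonality in the energy
space.
-/

/-! ### Hilbert–Schmidt operators -/

section HilbertSchmidt

variable {𝕜 E F : Type*} [RCLike 𝕜] [NormedAddCommGroup E] [InnerProductSpace 𝕜 E]
  [NormedAddCommGroup F] [InnerProductSpace 𝕜 F]

/-- A bounded operator is Hilbert–Schmidt if the sums of `‖K e‖ ^ 2` over finite orthonormal
families are bounded. Testing on finite families avoids the choice of a Hilbert basis. -/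
def IsHilbertSchmidt (K : E →L[𝕜] F) : Prop :=
  ∃ C : ℝ, ∀ (n : ℕ) (e : Fin n → E), Orthonormal 𝕜 e → ∑ i, ‖K (e i)‖ ^ 2 ≤ C

namespace IsHilbertSchmidt

-- A finite orthonormal family whose sum is within `ε ^ 2` of the supremum cannot be extended by a
-- unit vector `h` with `‖K h‖ > ε`.
theorem exists_orthonormal_norm_apply_le {K : E →L[𝕜] F} (hK : IsHilbertSchmidt K) {ε : ℝ}
    (hε : 0 < ε) : ∃ (n : ℕ) (e : Fin n → E), Orthonormal 𝕜 e ∧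
      ∀ h : E, (∀ i, inner 𝕜 (e i) h = 0) → ‖K h‖ ≤ ε * ‖h‖ := by
  obtain ⟨C, hC⟩ := hK
  let S : Set ℝ := {t | ∃ (n : ℕ) (e : Fin n → E), Orthonormal 𝕜 e ∧ ∑ i, ‖K (e i)‖ ^ 2 = t}
  have bddAbove : BddAbove S := ⟨C, by rintro _ ⟨n, e, he, rfl⟩; exact hC n e he⟩
  have nonempty : S.Nonempty := ⟨0, 0, Fin.elim0, Orthonormal.of_isEmpty _, by simp⟩
  obtain ⟨_, ⟨n, e, he, rfl⟩, near_sup⟩ := exists_lt_of_lt_csSup nonempty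
    (sub_lt_self (sSup S) (pow_pos hε 2))
  have unit_bound : ∀ h : E, ‖h‖ = 1 → (∀ i, inner 𝕜 (e i) h = 0) → ‖K h‖ ≤ ε := by
    intro h h1 horth
    have extended : Orthonormal 𝕜 (Matrix.vecCons h e) :=
      orthonormal_vecCons_iff.2 ⟨h1, fun i => inner_eq_zero_symm.1 (horth i), he⟩
    have le_sup := le_csSup bddAbove ⟨n + 1, _, extended, rfl⟩
    simp only [Fin.sum_univ_succ, Matrix.cons_val_zero, Matrix.cons_val_succ] at le_sup
    exact le_of_sq_le_sq (by linarith) hε.le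
  refine ⟨n, e, he, fun h horth => ?_⟩
  rcases eq_or_ne h 0 with rfl | h0
  · simp
  · have normalized := unit_bound ((‖h‖⁻¹ : 𝕜) • h) (norm_smul_inv_norm h0)
      fun i => by rw [inner_smul_right, horth i, mul_zero]
    rwa [map_smul, norm_smul, norm_inv, RCLike.norm_ofReal, abs_norm,
      inv_mul_le_iff₀ (norm_pos_iff.2 h0), mul_comm] at normalized

theorem isCompactOperator [CompleteSpace F] {K : E →L[𝕜] F} (hK : IsHilbertSchmidt K) :
    IsCompactOperator K := by
  refine (isClosed_setOfPred_isCompactOperator (σ₁₂ := RingHom.id 𝕜) (M₁ := E)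
    (M₂ := F)).closure_subset (Metric.mem_closure_iff.2 fun ε hε => ?_)
  obtain ⟨n, e, -, he⟩ := hK.exists_orthonormal_norm_apply_le (half_pos hε)
  let U : Submodule 𝕜 E := Submodule.span 𝕜 (range e)
  have : FiniteDimensional 𝕜 U := FiniteDimensional.span_of_finite 𝕜 (finite_range e)
  refine ⟨K.comp U.starProjection, ?_, ?_⟩
  · exact (isCompactOperator_of_locallyCompactSpace_rng (K.comp U.subtypeL)).comp_clm
      U.orthogonalProjectionOnto
  · have small : ‖K - K.comp U.starProjection‖ ≤ ε / 2 := by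
      refine ContinuousLinearMap.opNorm_le_bound _ (half_pos hε).le fun x => ?_
      have perp : x - U.starProjection x ∈ Uᗮ := U.sub_starProjection_mem_orthogonal x
      calc ‖(K - K.comp U.starProjection) x‖ = ‖K (x - U.starProjection x)‖ := by simp
        _ ≤ ε / 2 * ‖x - U.starProjection x‖ := he _ fun i =>
          U.inner_right_of_mem_orthogonal (Submodule.subset_span ⟨i, rfl⟩) perp
        _ ≤ ε / 2 * ‖x‖ := by
          gcongr
          rw [← Submodule.starProjection_orthogonal_val]
          exact Uᗮ.norm_starProjection_apply_le x
    rw [dist_eq_norm]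
    exact small.trans_lt (half_lt_self hε)

end IsHilbertSchmidt

end HilbertSchmidt

/-! ### The spectral theorem for compact symmetric operators -/

section CompactSymmetric

universe u v w

variable {𝕜 : Type v} {E : Type u} [RCLike 𝕜] [NormedAddCommGroup E] [InnerProductSpace 𝕜 E]

theorem eq_zero_of_forall_inner_hilbertBasis_eq_zero {ι : Type*} (b : HilbertBasis ι 𝕜 E) {x : E}
    (hx : ∀ i, inner 𝕜 (b i) x = 0) : x = 0 :=
  b.repr.map_eq_zero_iff.1 (lp.ext (funext fun i => (b.repr_apply_apply x i).trans (hx i)))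

theorem exists_hilbertBasis_of_orthogonalFamily [CompleteSpace E] {κ : Type w}
    {V : κ → Submodule 𝕜 E} [∀ k, CompleteSpace (V k)]
    (hV : OrthogonalFamily 𝕜 (fun k => V k) fun k => (V k).subtypeₗᵢ) (hV' : (⨆ k, V k)ᗮ = ⊥) :
    ∃ (ι : Type (max w u)) (b : HilbertBasis ι 𝕜 E) (k : ι → κ), ∀ i, b i ∈ V (k i) := by
  choose I B _ using fun k => exists_hilbertBasis 𝕜 (V k)
  have orthonormal : Orthonormal 𝕜 fun a : Σ k, I k => (B a.1 a.2 : E) :=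
    hV.orthonormal_sigma_orthonormal fun k => (B k).orthonormal
  have total : (Submodule.span 𝕜 (range fun a : Σ k, I k => (B a.1 a.2 : E)))ᗮ = ⊥ := by
    rw [eq_bot_iff, ← hV', ← Submodule.iInf_orthogonal]
    refine fun x hx => (Submodule.mem_iInf _).2 fun k => ?_
    rw [← Submodule.orthogonalProjectionOnto_eq_zero_iff]
    refine eq_zero_of_forall_inner_hilbertBasis_eq_zero (B k) fun i => ?_
    rw [Submodule.inner_orthogonalProjectionOnto_eq_of_mem_left]
    exact hx _ (Submodule.subset_span ⟨⟨k, i⟩, rfl⟩)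
  refine ⟨_, HilbertBasis.mkOfOrthogonalEqBot orthonormal total, Sigma.fst, fun a => ?_⟩
  rw [HilbertBasis.coe_mkOfOrthogonalEqBot]
  exact SetLike.coe_mem _

variable {K : E →L[𝕜] E}

theorem exists_hilbertBasis_eigenvectors [CompleteSpace E] (hK : IsCompactOperator K)
    (hsymm : (K : E →ₗ[𝕜] E).IsSymmetric) :
    ∃ (ι : Type (max v u)) (b : HilbertBasis ι 𝕜 E) (μ : ι → 𝕜), ∀ i, K (b i) = μ i • b i := by
  have (μ : 𝕜) : CompleteSpace (Module.End.eigenspace (K : E →ₗ[𝕜] E) μ) := by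
    have ker_eq : (Module.End.eigenspace (K : E →ₗ[𝕜] E) μ : Set E) = {x | K x = μ • x} :=
      Set.ext fun x => Module.End.mem_eigenspace_iff
    exact (ker_eq ▸ isClosed_eq K.continuous (continuous_const_smul μ)).completeSpace_coe
  obtain ⟨ι, b, μ, hb⟩ := exists_hilbertBasis_of_orthogonalFamily
    hsymm.orthogonalFamily_eigenspaces
    (ContinuousLinearMap.orthogonalComplement_iSup_eigenspaces_eq_bot hK hsymm)
  exact ⟨ι, b, μ, fun i => Module.End.mem_eigenspace_iff.1 (hb i)⟩

theorem finite_setOf_le_norm_eigenvalue (hK : IsCompactOperator K) {ι : Type*} {v : ι → E}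
    {μ : ι → 𝕜} (hv : Orthonormal 𝕜 v) (hKv : ∀ i, K (v i) = μ i • v i) {ε : ℝ} (hε : 0 < ε) :
    {i | ε ≤ ‖μ i‖}.Finite := by
  by_contra hinf
  let f : ℕ ↪ {i | ε ≤ ‖μ i‖} := Set.Infinite.natEmbedding _ hinf
  obtain ⟨S, hS, hsub⟩ := hK.image_closedBall_subset_compact (f := (K : E →ₗ[𝕜] E)) 1
  have mem_S (n : ℕ) : K (v (f n)) ∈ S :=
    hsub ⟨v (f n), by simp [hv.norm_eq_one], rfl⟩
  obtain ⟨_, -, φ, hφ, hlim⟩ := hS.tendsto_subseq mem_S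
  have separated {m n : ℕ} (hmn : m ≠ n) : ε ≤ dist (K (v (f m))) (K (v (f n))) := by
    have orth : inner 𝕜 (K (v (f m))) (K (v (f n))) = 0 := by
      rw [hKv, hKv, inner_smul_left, inner_smul_right,
        hv.inner_eq_zero (Subtype.coe_injective.ne (f.injective.ne hmn)), mul_zero, mul_zero]
    have norm_ge : ε ≤ ‖K (v (f m))‖ := by
      rw [hKv, norm_smul, hv.norm_eq_one, mul_one]
      exact (f m).2
    have pythagoras := norm_sub_sq (𝕜 := 𝕜) (K (v (f m))) (K (v (f n)))
    rw [orth, map_zero] at pythagoras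
    rw [dist_eq_norm]
    nlinarith [norm_nonneg (K (v (f m)) - K (v (f n)))]
  obtain ⟨N, hN⟩ := Metric.cauchySeq_iff.1 hlim.cauchySeq ε hε
  exact (hN N le_rfl (N + 1) N.le_succ).not_ge (separated (hφ.injective.ne N.succ_ne_self.symm))

theorem exists_hilbertBasis_nat_eigenvectors [CompleteSpace E] (hE : ¬ FiniteDimensional 𝕜 E)
    (hK : IsCompactOperator K) (hsymm : (K : E →ₗ[𝕜] E).IsSymmetric)
    (hinj : Function.Injective K) :
    ∃ (b : HilbertBasis ℕ 𝕜 E) (μ : ℕ → 𝕜), (∀ n, K (b n) = μ n • b n) ∧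
      Tendsto μ atTop (𝓝[≠] 0) := by
  obtain ⟨ι, b, μ, hb⟩ := exists_hilbertBasis_eigenvectors hK hsymm
  have μ_ne (i : ι) : μ i ≠ 0 := fun hi =>
    b.orthonormal.ne_zero i (hinj (by rw [hb i, hi, zero_smul, map_zero]))
  have μ_lim : Tendsto μ cofinite (𝓝 0) := by
    refine Metric.tendsto_nhds.2 fun ε hε => ?_
    simpa [eventually_cofinite] using
      finite_setOf_le_norm_eigenvalue hK b.orthonormal hb hε
  have : Countable ι := by
    have support_eq : (μ ⁻¹' {0})ᶜ = univ := by
      ext i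
      simp [μ_ne]
    rw [← countable_univ_iff, ← support_eq, ← ker_nhds]
    exact μ_lim.countable_compl_preimage_ker
  have : Infinite ι := not_finite_iff_infinite.1 fun hfin => by
    have := Fintype.ofFinite ι
    exact hE b.toOrthonormalBasis.toBasis.finiteDimensional_of_finite
  obtain ⟨e⟩ := nonempty_equiv_of_countable (α := ℕ) (β := ι)
  have total : (Submodule.span 𝕜 (range (b ∘ e)))ᗮ = ⊥ := by
    rw [e.surjective.range_comp, ← Submodule.topologicalClosure_eq_top_iff, b.dense_span]
  refine ⟨HilbertBasis.mkOfOrthogonalEqBot (b.orthonormal.comp e e.injective) total, μ ∘ e,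
    fun n => ?_, tendsto_nhdsWithin_iff.2 ⟨?_, Eventually.of_forall fun n => μ_ne (e n)⟩⟩
  · simp only [HilbertBasis.coe_mkOfOrthogonalEqBot, Function.comp_apply, hb]
  · rw [← Nat.cofinite_eq_atTop]
    exact μ_lim.comp e.injective.tendsto_cofinite

end CompactSymmetric

/-! ### Operators with a compact symmetric inverse -/

section BoundedInverse

variable {𝕜 E : Type*} [RCLike 𝕜] [NormedAddCommGroup E] [InnerProductSpace 𝕜 E]

/-- `K` is an everywhere defined bounded two-sided inverse of the unbounded operator `T`. -/
structure IsBoundedInverse (T : E →ₗ.[𝕜] E) (K : E →L[𝕜] E) : Prop where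
  mem_graph : ∀ y, (K y, y) ∈ T.graph
  apply_apply : ∀ x : T.domain, K (T x) = x

namespace IsBoundedInverse

variable {T : E →ₗ.[𝕜] E} {K : E →L[𝕜] E}

theorem exists_domain (h : IsBoundedInverse T K) (y : E) :
    ∃ x : T.domain, (x : E) = K y ∧ T x = y :=
  T.mem_graph_iff.1 (h.mem_graph y)

theorem injective (h : IsBoundedInverse T K) : Function.Injective K :=
  (injective_iff_map_eq_zero K).2 fun y hy => by
    obtain ⟨x, hx, rfl⟩ := h.exists_domain y
    rw [show x = 0 from Subtype.ext (hx.trans hy), LinearPMap.map_zero]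

theorem mem_eigenspace_iff (h : IsBoundedInverse T K) {μ : 𝕜} (hμ : μ ≠ 0) {x : E} :
    x ∈ T.eigenspace μ ↔ K x = μ⁻¹ • x := by
  constructor
  · rintro ⟨x, hx, rfl⟩
    have hTx : T x = μ • (x : E) := sub_eq_zero.1 hx
    have hKx : μ • K x = x := by rw [← map_smul, ← hTx, h.apply_apply]
    exact (eq_inv_smul_iff₀ hμ).2 hKx
  · intro hx
    obtain ⟨z, hz, hTz⟩ := h.exists_domain (μ • x)
    rw [map_smul, hx, smul_inv_smul₀ hμ] at hz
    subst hz
    exact ⟨z, sub_eq_zero.2 hTz, rfl⟩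

theorem mem_resolventSet (h : IsBoundedInverse T K) {μ : 𝕜} (hu : IsUnit (1 - μ • K)) :
    μ ∈ T.resolventSet := by
  obtain ⟨R, hRl, hRr⟩ := isUnit_iff_exists.1 hu
  have right_inv (y : E) : R y - μ • K (R y) = y := DFunLike.congr_fun hRl y
  have left_inv (y : E) : R (y - μ • K y) = y := DFunLike.congr_fun hRr y
  have shift_apply (x : T.domain) : T.shift μ x = T x - μ • K (T x) := by
    rw [h.apply_apply]; rfl
  have recover (x : T.domain) : (x : E) = K (R (T.shift μ x)) := by
    rw [shift_apply, left_inv, h.apply_apply]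
  refine ⟨⟨fun x y hxy => Subtype.ext ?_, fun y => ?_⟩, ‖K‖ * ‖R‖, fun x => ?_⟩
  · rw [recover x, recover y, hxy]
  · obtain ⟨x, -, hTx⟩ := h.exists_domain (R y)
    exact ⟨x, by rw [shift_apply, hTx, right_inv]⟩
  · calc ‖(x : E)‖ = ‖(K ∘L R) (T.shift μ x)‖ := congrArg _ (recover x)
      _ ≤ ‖K ∘L R‖ * ‖T.shift μ x‖ := (K ∘L R).le_opNorm _
      _ ≤ ‖K‖ * ‖R‖ * ‖T.shift μ x‖ := by gcongr; exact K.opNorm_comp_le R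

end IsBoundedInverse

theorem exists_apply_eq_smul_of_mem_eigenspace {T : E →ₗ.[𝕜] E} {μ : 𝕜} {x : E}
    (hx : x ∈ T.eigenspace μ) : ∃ h : x ∈ T.domain, T ⟨x, h⟩ = μ • x := by
  obtain ⟨z, hz, rfl⟩ := hx
  exact ⟨z.2, sub_eq_zero.1 hz⟩

theorem mem_spectrum_of_eigenspace_ne_bot {T : E →ₗ.[𝕜] E} {μ : 𝕜} (h : T.eigenspace μ ≠ ⊥) :
    μ ∈ T.spectrum := by
  rintro ⟨⟨hinj, -⟩, -⟩
  rw [LinearPMap.eigenspace, LinearMap.ker_eq_bot.2 hinj, Submodule.map_bot] at h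
  exact h rfl

theorem IsBoundedInverse.eigenspace_ne_bot_of_mem_spectrum [CompleteSpace E] {T : E →ₗ.[𝕜] E}
    {K : E →L[𝕜] E} (h : IsBoundedInverse T K) (hK : IsCompactOperator K) {μ : 𝕜}
    (hμ : μ ∈ T.spectrum) : μ ≠ 0 ∧ T.eigenspace μ ≠ ⊥ := by
  have not_unit : ¬ IsUnit (1 - μ • K) := fun hu => hμ (h.mem_resolventSet hu)
  have μ_ne : μ ≠ 0 := by
    rintro rfl
    simp at not_unit
  refine ⟨μ_ne, fun hbot => not_unit ?_⟩
  have no_eigenvalue : ¬ Module.End.HasEigenvalue (K : Module.End 𝕜 E) μ⁻¹ := fun hev => by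
    obtain ⟨x, hx⟩ := hev.exists_hasEigenvector
    have mem : x ∈ T.eigenspace μ := (h.mem_eigenspace_iff μ_ne).2 hx.apply_eq_smul
    rw [hbot] at mem
    exact hx.2 mem
  have unit : IsUnit (algebraMap 𝕜 (E →L[𝕜] E) μ⁻¹ - K) :=
    (hK.hasEigenvalue_or_mem_resolventSet (inv_ne_zero μ_ne)).resolve_left no_eigenvalue
  have rescale : 1 - μ • K = Units.mk0 μ μ_ne • (algebraMap 𝕜 (E →L[𝕜] E) μ⁻¹ - K) := by
    rw [Units.smul_mk0, smul_sub, Algebra.algebraMap_eq_smul_one, smul_inv_smul₀ μ_ne]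
  rw [rescale]
  exact unit.smul _

theorem not_accPt_range_of_tendsto_cobounded {X ι : Type*} [MetricSpace X] {f : ι → X}
    (hf : Tendsto f cofinite (Bornology.cobounded X)) (x : X) : ¬ AccPt x (𝓟 (range f)) := by
  intro hx
  have finite_preimage : (f ⁻¹' Metric.ball x 1).Finite := by
    have := hf (Bornology.isBounded_def.1 (Metric.isBounded_ball (x := x) (r := 1)))
    rwa [mem_map, mem_cofinite, preimage_compl, compl_compl] at this
  refine Set.Infinite.of_accPt (hx.nhds_inter (Metric.ball_mem_nhds x one_pos)) ?_
  rw [← image_preimage_eq_inter_range]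
  exact finite_preimage.image f

theorem IsBoundedInverse.exists_hilbertBasis_eigenspace [CompleteSpace E]
    (hE : ¬ FiniteDimensional 𝕜 E) {T : E →ₗ.[𝕜] E} {K : E →L[𝕜] E} (h : IsBoundedInverse T K)
    (hK : IsCompactOperator K) (hsymm : (K : E →ₗ[𝕜] E).IsSymmetric) :
    ∃ (b : HilbertBasis ℕ 𝕜 E) (lam : ℕ → 𝕜), Tendsto lam atTop (Bornology.cobounded 𝕜) ∧
      T.spectrum = range lam ∧ ∀ n, lam n ≠ 0 ∧ b n ∈ T.eigenspace (lam n) := by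
  obtain ⟨b, μ, hb, hμ⟩ := exists_hilbertBasis_nat_eigenvectors hE hK hsymm h.injective
  have μ_ne (n : ℕ) : μ n ≠ 0 := fun hn => b.orthonormal.ne_zero n <| h.injective <| by
    rw [hb, hn, zero_smul, map_zero]
  have eigen (n : ℕ) : b n ∈ T.eigenspace (μ n)⁻¹ :=
    (h.mem_eigenspace_iff (inv_ne_zero (μ_ne n))).2 (by rw [hb, inv_inv])
  refine ⟨b, fun n => (μ n)⁻¹, tendsto_inv₀_nhdsNE_zero.comp hμ, ?_,
    fun n => ⟨inv_ne_zero (μ_ne n), eigen n⟩⟩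
  refine Subset.antisymm (fun ν hν => ?_) ?_
  · obtain ⟨ν_ne, hν_eigen⟩ := h.eigenspace_ne_bot_of_mem_spectrum hK hν
    by_contra hnot
    refine hν_eigen ((Submodule.eq_bot_iff _).2 fun x hx => ?_)
    refine eq_zero_of_forall_inner_hilbertBasis_eq_zero b fun n => ?_
    have μ_ne_inv : μ n ≠ ν⁻¹ := fun hμν => hnot ⟨n, inv_eq_iff_eq_inv.2 hμν⟩
    exact hsymm.orthogonalFamily_eigenspaces μ_ne_inv ⟨b n, Module.End.mem_eigenspace_iff.2 (hb n)⟩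
      ⟨x, Module.End.mem_eigenspace_iff.2 ((h.mem_eigenspace_iff ν_ne).1 hx)⟩
  · rintro _ ⟨n, rfl⟩
    exact mem_spectrum_of_eigenspace_ne_bot
      ((Submodule.ne_bot_iff _).2 ⟨b n, eigen n, b.orthonormal.ne_zero n⟩)

theorem IsBoundedInverse.hasDiscreteSpectrum [CompleteSpace E] {T : E →ₗ.[𝕜] E} {K : E →L[𝕜] E}
    (h : IsBoundedInverse T K) (hK : IsCompactOperator K) {ι : Type*} {lam : ι → 𝕜}
    (hlam : Tendsto lam cofinite (Bornology.cobounded 𝕜)) (hspec : T.spectrum = range lam) :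
    T.HasDiscreteSpectrum where
  eigenspace_ne_bot μ hμ := (h.eigenspace_ne_bot_of_mem_spectrum hK hμ).2
  finiteDimensional μ hμ := by
    have μ_ne := (h.eigenspace_ne_bot_of_mem_spectrum hK hμ).1
    have := ContinuousLinearMap.finite_dimensional_eigenspace hK μ⁻¹ (inv_ne_zero μ_ne)
    exact Submodule.finiteDimensional_of_le (S₂ := Module.End.eigenspace K.toLinearMap μ⁻¹)
      fun x hx => Module.End.mem_eigenspace_iff.2 ((h.mem_eigenspace_iff μ_ne).1 hx)
  not_accPt μ := hspec ▸ not_accPt_range_of_tendsto_cobounded hlam μ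

end BoundedInverse

/-! ### Inverting the Friedrichs extension -/

section FriedrichsInverse

variable {𝕜 E : Type*} [RCLike 𝕜] [NormedAddCommGroup E] [InnerProductSpace 𝕜 E]
  {T : E →ₗ.[𝕜] E} {K : E →L[𝕜] E}

theorem apply_mem_energySpace (hT : ∀ x : T.domain, 0 ≤ T.energy x)
    (hr : Dense {f : E | (K f, f) ∈ T.graph}) (f : E) : K f ∈ T.energySpace hT := by
  obtain ⟨u, hu, hlim⟩ := mem_closure_iff_seq_limit.1 (hr f)
  choose w hw hTw using fun n => T.mem_graph_iff.1 (hu n)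
  refine ⟨w, ?_, ?_⟩
  · simp only [hw]
    exact (K.continuous.tendsto f).comp hlim
  · have energy_eq (p : ℕ × ℕ) : T.energy (w p.1 - w p.2) =
        RCLike.re (inner 𝕜 (u p.1 - u p.2) (K (u p.1 - u p.2))) := by
      rw [LinearPMap.energy, LinearPMap.map_sub, Submodule.coe_sub, hTw, hTw, hw, hw, map_sub]
    have cauchy : Tendsto (fun p : ℕ × ℕ => u p.1 - u p.2) atTop (𝓝 0) := by
      rw [← prod_atTop_atTop_eq, ← sub_self f]
      exact (hlim.comp tendsto_fst).sub (hlim.comp tendsto_snd)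
    have quadratic : Continuous fun x : E => RCLike.re (inner 𝕜 x (K x)) := by fun_prop
    simp only [energy_eq]
    exact (quadratic.tendsto' 0 0 (by simp)).comp cauchy

variable [CompleteSpace E]

theorem mem_graph_friedrichsExtension_iff {hT : ∀ x : T.domain, 0 ≤ T.energy x} {p : E × E} :
    p ∈ (T.friedrichsExtension hT).graph ↔ p.1 ∈ T.energySpace hT ∧ p ∈ T.adjoint.graph := by
  simp only [LinearPMap.mem_graph_iff]
  constructor
  · rintro ⟨y, hy, hTy⟩
    exact ⟨hy ▸ y.2.1, ⟨(y : E), y.2.2⟩, hy, (LinearPMap.domRestrict_apply rfl).symm.trans hTy⟩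
  · rintro ⟨hp, y, hy, hTy⟩
    exact ⟨⟨(y : E), hy ▸ hp, y.2⟩, hy, (LinearPMap.domRestrict_apply rfl).trans hTy⟩

theorem prodMk_mem_adjoint_graph (hd : Dense (T.domain : Set E))
    (hsymm : (K : E →ₗ[𝕜] E).IsSymmetric) (hl : ∀ x : T.domain, K (T x) = x) (f : E) :
    (K f, f) ∈ T.adjoint.graph := by
  have formal_adjoint (x : T.domain) : inner 𝕜 f (x : E) = inner 𝕜 (K f) (T x) := by
    rw [← hl x]
    exact (hsymm f (T x)).symm
  have mem : K f ∈ T.adjoint.domain := LinearPMap.mem_adjoint_domain_of_exists _ ⟨f, formal_adjoint⟩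
  exact T.adjoint.mem_graph_iff.2 ⟨⟨K f, mem⟩, rfl, LinearPMap.adjoint_apply_eq hd _ formal_adjoint⟩

theorem apply_eq_of_mem_adjoint_graph (hd : Dense (T.domain : Set E))
    (hsymm : (K : E →ₗ[𝕜] E).IsSymmetric) (hr : Dense {f : E | (K f, f) ∈ T.graph}) {p : E × E}
    (hp : p ∈ T.adjoint.graph) : K p.2 = p.1 := by
  obtain ⟨z, hz, hTz⟩ := T.adjoint.mem_graph_iff.1 hp
  refine hr.eq_of_inner_left 𝕜 fun f hf => ?_
  obtain ⟨w, hw, hTw⟩ := T.mem_graph_iff.1 hf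
  simp only at hw hTw
  calc inner 𝕜 (K p.2) f = inner 𝕜 p.2 (K f) := hsymm p.2 f
    _ = inner 𝕜 (T.adjoint z) (w : E) := by rw [hTz, hw]
    _ = inner 𝕜 (z : E) (T w) := LinearPMap.adjoint_isFormalAdjoint hd z w
    _ = inner 𝕜 p.1 f := by rw [hz, hTw]

theorem isBoundedInverse_friedrichsExtension (hT : ∀ x : T.domain, 0 ≤ T.energy x)
    (hd : Dense (T.domain : Set E)) (hsymm : (K : E →ₗ[𝕜] E).IsSymmetric)
    (hl : ∀ x : T.domain, K (T x) = x) (hr : Dense {f : E | (K f, f) ∈ T.graph}) :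
    IsBoundedInverse (T.friedrichsExtension hT) K where
  mem_graph f := mem_graph_friedrichsExtension_iff.2
    ⟨apply_mem_energySpace hT hr f, prodMk_mem_adjoint_graph hd hsymm hl f⟩
  apply_apply x := apply_eq_of_mem_adjoint_graph hd hsymm hr
    (mem_graph_friedrichsExtension_iff.1 ((T.friedrichsExtension hT).mem_graph x)).2

end FriedrichsInverse

/-! ### Integral operators with square integrable kernel -/

section Kernel

variable {α β 𝕜 : Type*} [MeasurableSpace β] [RCLike 𝕜] {ν : Measure β} {k : α → β → 𝕜}

/-- The integral operator with kernel `k`, on functions. -/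
noncomputable def kernelFun (ν : Measure β) (k : α → β → 𝕜) (f : β → 𝕜) (x : α) : 𝕜 :=
  ∫ y, k x y * f y ∂ν

theorem kernelFun_congr_ae {f g : β → 𝕜} (hfg : f =ᵐ[ν] g) : kernelFun ν k f = kernelFun ν k g :=
  funext fun x => integral_congr_ae (hfg.mono fun y hy => by simp only [hy])

theorem norm_sq_eq_integral_norm_sq (f : Lp 𝕜 2 ν) : ‖f‖ ^ 2 = ∫ y, ‖f y‖ ^ 2 ∂ν := by
  rw [← RCLike.ofReal_inj (K := 𝕜), ← integral_ofReal, RCLike.ofReal_pow,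
    ← inner_self_eq_norm_sq_to_K, L2.inner_def]
  exact integral_congr_ae (.of_forall fun y => by simp [inner_self_eq_norm_sq_to_K])

variable [MeasurableSpace α] {μ : Measure α} [SFinite ν]

theorem ae_memLp_section (hk : MemLp (Function.uncurry k) 2 (μ.prod ν)) :
    ∀ᵐ x ∂μ, MemLp (k x) 2 ν := by
  have integrable := hk.integrable_norm_pow two_ne_zero
  filter_upwards [hk.1.prodMk_left, ((integrable_prod_iff integrable.1).1 integrable).1]
    with x meas integrable_x
  exact (memLp_two_iff_integrable_sq_norm meas).2 integrable_x

theorem ae_exists_kernelFun_eq_inner (hk : MemLp (Function.uncurry k) 2 (μ.prod ν)) :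
    ∀ᵐ x ∂μ, ∃ κ : Lp 𝕜 2 ν, ‖κ‖ ^ 2 = ∫ y, ‖k x y‖ ^ 2 ∂ν ∧
      ∀ f : Lp 𝕜 2 ν, kernelFun ν k f x = inner 𝕜 κ f := by
  filter_upwards [ae_memLp_section hk] with x hx
  refine ⟨hx.star.toLp, ?_, fun f => ?_⟩
  · rw [norm_sq_eq_integral_norm_sq]
    refine integral_congr_ae ?_
    filter_upwards [hx.star.coeFn_toLp] with y hy
    rw [hy, Pi.star_apply, norm_star]
  · rw [L2.inner_def, kernelFun]
    refine integral_congr_ae ?_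
    filter_upwards [hx.star.coeFn_toLp] with y hy
    simp [hy, mul_comm]

theorem integrable_integral_norm_sq (hk : MemLp (Function.uncurry k) 2 (μ.prod ν)) :
    Integrable (fun x => ∫ y, ‖k x y‖ ^ 2 ∂ν) μ :=
  (hk.integrable_norm_pow two_ne_zero).integral_prod_left

theorem ae_norm_sq_kernelFun_le (hk : MemLp (Function.uncurry k) 2 (μ.prod ν)) (f : Lp 𝕜 2 ν) :
    ∀ᵐ x ∂μ, ‖kernelFun ν k f x‖ ^ 2 ≤ (∫ y, ‖k x y‖ ^ 2 ∂ν) * ‖f‖ ^ 2 := by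
  filter_upwards [ae_exists_kernelFun_eq_inner hk] with x ⟨κ, hκ, hκf⟩
  rw [hκf f, ← hκ, ← mul_pow]
  gcongr
  exact norm_inner_le_norm κ f

theorem memLp_kernelFun (hk : MemLp (Function.uncurry k) 2 (μ.prod ν)) (f : Lp 𝕜 2 ν) :
    MemLp (kernelFun ν k f) 2 μ := by
  have meas : AEStronglyMeasurable (kernelFun ν k f) μ :=
    (hk.1.mul (Lp.aestronglyMeasurable f).comp_snd).integral_prod_right'
  refine (memLp_two_iff_integrable_sq_norm meas).2 ?_
  refine ((integrable_integral_norm_sq hk).mul_const (‖f‖ ^ 2)).mono' (meas.norm.pow 2) ?_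
  filter_upwards [ae_norm_sq_kernelFun_le hk f] with x hx
  rwa [norm_pow, norm_norm]

theorem norm_toLp_kernelFun_le (hk : MemLp (Function.uncurry k) 2 (μ.prod ν)) (f : Lp 𝕜 2 ν) :
    ‖(memLp_kernelFun hk f).toLp‖ ≤ √(∫ x, ∫ y, ‖k x y‖ ^ 2 ∂ν ∂μ) * ‖f‖ := by
  refine le_of_sq_le_sq ?_ (by positivity)
  rw [mul_pow, Real.sq_sqrt (by positivity), norm_sq_eq_integral_norm_sq, ← integral_mul_const]
  refine integral_mono_ae ((Lp.memLp _).integrable_norm_pow two_ne_zero)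
    ((integrable_integral_norm_sq hk).mul_const _) ?_
  filter_upwards [(memLp_kernelFun hk f).coeFn_toLp, ae_norm_sq_kernelFun_le hk f] with x hx hle
  rwa [hx]

/-- The integral operator on `L²` with a square integrable kernel `k`. -/
noncomputable def kernelOperator (hk : MemLp (Function.uncurry k) 2 (μ.prod ν)) :
    Lp 𝕜 2 ν →L[𝕜] Lp 𝕜 2 μ :=
  LinearMap.mkContinuous
    { toFun := fun f => (memLp_kernelFun hk f).toLp
      map_add' := fun f g => by
        rw [← MemLp.toLp_add]
        refine MemLp.toLp_congr _ _ ?_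
        filter_upwards [ae_exists_kernelFun_eq_inner hk] with x ⟨κ, _, hκ⟩
        rw [Pi.add_apply, hκ, hκ, hκ, inner_add_right]
      map_smul' := fun c f => by
        rw [RingHom.id_apply, ← MemLp.toLp_const_smul]
        refine MemLp.toLp_congr _ _ ?_
        filter_upwards [ae_exists_kernelFun_eq_inner hk] with x ⟨κ, _, hκ⟩
        rw [Pi.smul_apply, hκ, hκ, inner_smul_right, smul_eq_mul] }
    (√(∫ x, ∫ y, ‖k x y‖ ^ 2 ∂ν ∂μ)) (norm_toLp_kernelFun_le hk)

theorem kernelOperator_apply_ae (hk : MemLp (Function.uncurry k) 2 (μ.prod ν)) (f : Lp 𝕜 2 ν) :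
    kernelOperator hk f =ᵐ[μ] kernelFun ν k f :=
  (memLp_kernelFun hk f).coeFn_toLp

-- Bessel's inequality, applied to almost every section of the kernel.
theorem isHilbertSchmidt_kernelOperator (hk : MemLp (Function.uncurry k) 2 (μ.prod ν)) :
    IsHilbertSchmidt (kernelOperator hk) := by
  refine ⟨∫ x, ∫ y, ‖k x y‖ ^ 2 ∂ν ∂μ, fun n e he => ?_⟩
  have integrable (i : Fin n) : Integrable (fun x => ‖kernelOperator hk (e i) x‖ ^ 2) μ :=
    (Lp.memLp _).integrable_norm_pow two_ne_zero
  simp only [norm_sq_eq_integral_norm_sq (kernelOperator hk (e _))]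
  rw [← integral_finsetSum _ fun i _ => integrable i]
  refine integral_mono_ae (integrable_finsetSum _ fun i _ => integrable i)
    (integrable_integral_norm_sq hk) ?_
  filter_upwards [ae_exists_kernelFun_eq_inner hk,
    ae_all_iff.2 fun i => kernelOperator_apply_ae hk (e i)] with x ⟨κ, hκ, hκe⟩ hx
  calc ∑ i, ‖kernelOperator hk (e i) x‖ ^ 2 = ∑ i, ‖inner 𝕜 (e i) κ‖ ^ 2 :=
        Finset.sum_congr rfl fun i _ => by rw [hx i, hκe, norm_inner_symm]
    _ ≤ ‖κ‖ ^ 2 := he.sum_inner_products_le κ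
    _ = ∫ y, ‖k x y‖ ^ 2 ∂ν := hκ

theorem isSymmetric_kernelOperator [SFinite μ] {k : α → α → 𝕜}
    (hk : MemLp (Function.uncurry k) 2 (μ.prod μ)) (hsymm : ∀ x y, k x y = star (k y x)) :
    (kernelOperator hk : Lp 𝕜 2 μ →ₗ[𝕜] Lp 𝕜 2 μ).IsSymmetric := by
  intro f g
  have tensor : MemLp (fun p : α × α => g p.2 * star (f p.1)) 2 (μ.prod μ) := by
    have meas : AEStronglyMeasurable (fun p : α × α => g p.2 * star (f p.1)) (μ.prod μ) :=
      (Lp.aestronglyMeasurable g).comp_snd.mul (Lp.aestronglyMeasurable f).star.comp_fst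
    refine (memLp_two_iff_integrable_sq_norm meas).2 ?_
    simpa only [norm_mul, norm_star, mul_pow, mul_comm] using
      ((Lp.memLp f).integrable_norm_pow two_ne_zero).mul_prod
        ((Lp.memLp g).integrable_norm_pow two_ne_zero)
  have integrable : Integrable (Function.uncurry fun x y => k x y * (g y * star (f x)))
      (μ.prod μ) := hk.integrable_mul tensor
  calc inner 𝕜 (kernelOperator hk f) g = ∫ y, ∫ x, k x y * (g y * star (f x)) ∂μ ∂μ := by
        rw [L2.inner_def]
        refine integral_congr_ae ?_
        filter_upwards [kernelOperator_apply_ae hk f] with y hy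
        rw [hy, kernelFun, RCLike.inner_apply, ← integral_conj, ← integral_const_mul]
        refine integral_congr_ae (.of_forall fun x => ?_)
        simp only [hsymm x y, map_mul, RCLike.star_def]
        ring
    _ = ∫ x, ∫ y, k x y * (g y * star (f x)) ∂μ ∂μ := (integral_integral_swap integrable).symm
    _ = inner 𝕜 f (kernelOperator hk g) := by
        rw [L2.inner_def]
        refine integral_congr_ae ?_
        filter_upwards [kernelOperator_apply_ae hk g] with x hx
        rw [hx, kernelFun, RCLike.inner_apply, ← integral_mul_const]
        simp only [mul_assoc, RCLike.star_def]

end Kernel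

/-! ### Eigenfunctions of integral operators are bounded -/

section Bounded

variable {α 𝕜 : Type*} [RCLike 𝕜]

theorem exists_setIntegral_lt_of_integrable [MeasurableSpace α] {μ : Measure α} {g h : α → ℝ}
    (hg : Integrable g μ) (hh : AEMeasurable h μ) {ε : ℝ} (hε : 0 < ε) :
    ∃ n : ℕ, ∫ x in {x | n < h x}, g x ∂μ < ε := by
  have nullMeasurable (n : ℕ) : NullMeasurableSet {x | (n : ℝ) < h x} μ :=
    nullMeasurableSet_lt aemeasurable_const hh
  have tendsto : Tendsto (fun n : ℕ => ∫ x, {x | (n : ℝ) < h x}.indicator g x ∂μ) atTop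
      (𝓝 (∫ _, 0 ∂μ)) := by
    refine tendsto_integral_of_dominated_convergence (fun x => ‖g x‖)
      (fun n => (hg.indicator₀ (nullMeasurable n)).aestronglyMeasurable) hg.norm
      (fun n => .of_forall fun x => norm_indicator_le_norm_self g x) (.of_forall fun x => ?_)
    refine tendsto_const_nhds.congr' ?_
    filter_upwards [tendsto_natCast_atTop_atTop.eventually_ge_atTop (h x)] with n hn
    exact (indicator_of_notMem (s := {x | (n : ℝ) < h x}) hn.not_gt g).symm
  rw [integral_zero] at tendsto
  simpa only [integral_indicator₀ (nullMeasurable _)] using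
    (tendsto.eventually_lt_const hε).exists

variable [MeasurableSpace α] {μ : Measure α} {k : α → α → 𝕜} {h : α → ℝ} {u : α → 𝕜}

theorem memLp_max_norm_sub (hu : MemLp u 2 μ) {M : ℝ} (hM : 0 ≤ M) :
    MemLp (fun y => max (‖u y‖ - M) 0) 2 μ := by
  refine hu.mono ((hu.1.norm.sub aestronglyMeasurable_const).sup aestronglyMeasurable_const)
    (.of_forall fun y => ?_)
  rw [Real.norm_of_nonneg (le_max_right _ _)]
  exact max_le (sub_le_self _ hM) (norm_nonneg _)

-- On `{R < h}` split `‖u‖ ≤ (‖u‖ - M)⁺ + M`; elsewhere `h ^ 2 ≤ R * h`.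
theorem norm_kernelFun_le_add (hh0 : ∀ x, 0 ≤ h x) (hh2 : MemLp h 2 μ) (hu : MemLp u 2 μ) {x : α}
    (hk : ∀ᵐ y ∂μ, ‖k x y‖ ≤ h x * h y ∧ ‖k x y‖ ≤ h y ^ 2) {R M : ℝ} (hR : 0 ≤ R) (hM : 0 ≤ M) :
    ‖kernelFun μ k u x‖ ≤ h x * (∫ y in {y | R < h y}, h y * max (‖u y‖ - M) 0 ∂μ)
      + M * (∫ y in {y | R < h y}, h y ^ 2 ∂μ) + R * ∫ y, h y * ‖u y‖ ∂μ := by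
  set S := {y | R < h y}
  have nullMeasurable_S : NullMeasurableSet S μ :=
    nullMeasurableSet_lt aemeasurable_const hh2.1.aemeasurable
  have integrable_excess : Integrable (fun y => h x * (h y * max (‖u y‖ - M) 0)) μ :=
    (hh2.integrable_mul (memLp_max_norm_sub hu hM)).const_mul (h x)
  have integrable_sq : Integrable (fun y => M * h y ^ 2) μ := hh2.integrable_sq.const_mul M
  have integrable_mul : Integrable (fun y => R * (h y * ‖u y‖)) μ :=
    (hh2.integrable_mul hu.norm).const_mul R
  have integrable_indicator : Integrable (S.indicator fun y =>
      h x * (h y * max (‖u y‖ - M) 0) + M * h y ^ 2) μ :=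
    (integrable_excess.add integrable_sq).indicator₀ nullMeasurable_S
  rw [← integral_const_mul, ← integral_const_mul, ← integral_const_mul,
    ← integral_add integrable_excess.integrableOn integrable_sq.integrableOn,
    ← integral_indicator₀ nullMeasurable_S, ← integral_add integrable_indicator integrable_mul]
  refine norm_integral_le_of_norm_le (integrable_indicator.add integrable_mul) ?_
  filter_upwards [hk] with y ⟨hxy, hyy⟩
  have hu0 := norm_nonneg (u y)
  have hhu : 0 ≤ R * (h y * ‖u y‖) := mul_nonneg hR (mul_nonneg (hh0 y) hu0)
  rw [norm_mul]
  by_cases hy : y ∈ S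
  · rw [indicator_of_mem hy]
    calc ‖k x y‖ * ‖u y‖ ≤ ‖k x y‖ * (max (‖u y‖ - M) 0 + M) := by
          gcongr; exact sub_le_iff_le_add.1 (le_max_left _ _)
      _ ≤ h x * h y * max (‖u y‖ - M) 0 + h y ^ 2 * M := by
          rw [mul_add]; gcongr
      _ ≤ _ := by linarith
  · rw [indicator_of_notMem hy, zero_add]
    calc ‖k x y‖ * ‖u y‖ ≤ h y ^ 2 * ‖u y‖ := by gcongr
      _ ≤ R * h y * ‖u y‖ := by rw [sq]; gcongr; exacts [hh0 y, not_lt.1 hy]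
      _ = R * (h y * ‖u y‖) := mul_assoc _ _ _

theorem exists_ae_norm_le_of_eq_mul_kernelFun (hh0 : ∀ x, 0 ≤ h x) (hh2 : MemLp h 2 μ)
    (hk : ∀ᵐ x ∂μ, ∀ᵐ y ∂μ, ‖k x y‖ ≤ h x * h y ∧ ‖k x y‖ ≤ h y ^ 2) (hu : MemLp u 2 μ)
    {c : 𝕜} (huc : ∀ᵐ x ∂μ, u x = c * kernelFun μ k u x) :
    ∃ M, ∀ᵐ x ∂μ, ‖u x‖ ≤ M := by
  obtain ⟨R, hR⟩ := exists_setIntegral_lt_of_integrable hh2.integrable_sq hh2.1.aemeasurable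
    (ε := 1 / (2 * (‖c‖ + 1))) (by positivity)
  set J := ∫ y in {y | R < h y}, h y ^ 2 ∂μ
  set A := ‖c‖ * (R * ∫ y, h y * ‖u y‖ ∂μ)
  set I := ∫ y in {y | R < h y}, h y * max (‖u y‖ - 2 * A) 0 ∂μ
  have hA : 0 ≤ A := mul_nonneg (norm_nonneg c) (mul_nonneg R.cast_nonneg
    (integral_nonneg fun y => mul_nonneg (hh0 y) (norm_nonneg _)))
  have hI : 0 ≤ I := integral_nonneg fun y => mul_nonneg (hh0 y) (le_max_right _ _)
  have hJ : 0 ≤ J := integral_nonneg fun y => sq_nonneg _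
  have small : ‖c‖ * J ≤ 1 / 2 := by
    have := (lt_div_iff₀ (by positivity)).1 hR
    nlinarith
  have excess : ∀ᵐ x ∂μ, max (‖u x‖ - 2 * A) 0 ≤ ‖c‖ * I * h x := by
    filter_upwards [hk, huc] with x hkx hux
    have := norm_kernelFun_le_add hh0 hh2 hu hkx R.cast_nonneg (by positivity : 0 ≤ 2 * A)
    have := mul_le_mul_of_nonneg_left this (norm_nonneg c)
    rw [← norm_mul, ← hux] at this
    refine max_le ?_ (by have := hh0 x; positivity)
    nlinarith
  have contraction : I ≤ ‖c‖ * I * J := by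
    rw [← integral_const_mul]
    refine integral_mono_ae (hh2.integrable_mul
      (memLp_max_norm_sub hu (by positivity))).integrableOn
      (hh2.integrable_sq.const_mul _).integrableOn (ae_restrict_of_ae ?_)
    filter_upwards [excess] with y hy
    nlinarith [mul_le_mul_of_nonneg_left hy (hh0 y)]
  have I_eq_zero : I = 0 := by nlinarith
  refine ⟨2 * A, excess.mono fun x hx => ?_⟩
  rw [I_eq_zero, mul_zero, zero_mul] at hx
  linarith [le_max_left (‖u x‖ - 2 * A) 0]

end Bounded

/-! ### Primitives on an interval -/

section Primitive

variable {a b : ℝ} {f g : ℝ → ℝ}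

theorem hasDerivAt_integral_right_of_continuousOn_Ioo (hg : IntervalIntegrable g volume a b)
    (hc : ContinuousOn g (Ioo a b)) {x : ℝ} (hx : x ∈ Ioo a b) :
    HasDerivAt (fun x => ∫ t in a..x, g t) (g x) x :=
  intervalIntegral.integral_hasDerivAt_right
    (hg.mono_set (uIcc_subset_uIcc_left (Icc_subset_uIcc (Ioo_subset_Icc_self hx))))
    (hc.stronglyMeasurableAtFilter isOpen_Ioo x hx) (hc.continuousAt (isOpen_Ioo.mem_nhds hx))

theorem hasDerivAt_integral_left_of_continuousOn_Ioo (hg : IntervalIntegrable g volume a b)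
    (hc : ContinuousOn g (Ioo a b)) {x : ℝ} (hx : x ∈ Ioo a b) :
    HasDerivAt (fun x => ∫ t in x..b, g t) (-g x) x :=
  intervalIntegral.integral_hasDerivAt_left
    (hg.mono_set (uIcc_subset_uIcc_right (Icc_subset_uIcc (Ioo_subset_Icc_self hx))))
    (hc.stronglyMeasurableAtFilter isOpen_Ioo x hx) (hc.continuousAt (isOpen_Ioo.mem_nhds hx))

theorem absolutelyContinuousOnInterval_congr (hf : AbsolutelyContinuousOnInterval f a b)
    (hfg : EqOn f g (uIcc a b)) : AbsolutelyContinuousOnInterval g a b := by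
  refine hf.congr' ?_
  filter_upwards [mem_inf_of_right (mem_principal_self _)] with E hE
  refine Finset.sum_congr rfl fun i hi => ?_
  rw [hfg (hE.1 i hi).1, hfg (hE.1 i hi).2]

theorem absolutelyContinuousOnInterval_of_hasDerivAt (hab : a ≤ b) (hf : ContinuousOn f (Icc a b))
    (hd : ∀ x ∈ Ioo a b, HasDerivAt f (g x) x) (hg : IntervalIntegrable g volume a b) :
    AbsolutelyContinuousOnInterval f a b := by
  have const : AbsolutelyContinuousOnInterval (fun _ => f a) a b :=
    contDiffOn_const.absolutelyContinuousOnInterval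
  refine absolutelyContinuousOnInterval_congr
    (const.add (hg.absolutelyContinuousOnInterval_intervalIntegral left_mem_uIcc))
    fun x hx => ?_
  rw [uIcc_of_le hab] at hx
  rw [Pi.add_apply, intervalIntegral.integral_eq_sub_of_hasDerivAt_of_le hx.1
    (hf.mono (Icc_subset_Icc_right hx.2)) (fun t ht => hd t ⟨ht.1, ht.2.trans_le hx.2⟩)
    (hg.mono_set (uIcc_subset_uIcc_left (Icc_subset_uIcc hx))), add_sub_cancel]

end Primitive

namespace Degenerate

variable {β : ℝ}

/-! ### Homogeneous solutions -/

/-- The flux `x ^ β u'` of the solution `leftSolution β`. -/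
noncomputable def leftFlux (β : ℝ) : ℝ := max 0 (1 - β)

/-- The solution of `(x ^ β u')' = 0` that meets the left boundary condition of `D(A)`:
`x ^ (1 - β)` if `β < 1`, where `u(0) = 0` is prescribed, and `1` if `1 ≤ β`, where the flux of a
function bounded near `0` vanishes at `0`. -/
noncomputable def leftSolution (β x : ℝ) : ℝ := x ^ leftFlux β

/-- The solution of `(x ^ β u')' = 0` with `u(1) = 0` and flux `-1`. -/
noncomputable def rightSolution (β x : ℝ) : ℝ := ∫ t in x..1, t ^ (-β)

theorem leftFlux_of_one_le (hβ : 1 ≤ β) : leftFlux β = 0 := max_eq_left (sub_nonpos.2 hβ)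

theorem leftFlux_of_lt_one (hβ : β < 1) : leftFlux β = 1 - β := max_eq_right (sub_pos.2 hβ).le

theorem leftSolution_zero (hβ : β < 1) : leftSolution β 0 = 0 := by
  rw [leftSolution, leftFlux_of_lt_one hβ, Real.zero_rpow (sub_pos.2 hβ).ne']

theorem continuous_leftSolution : Continuous (leftSolution β) :=
  Real.continuous_rpow_const (le_max_left _ _)

theorem leftSolution_nonneg {x : ℝ} (hx : 0 ≤ x) : 0 ≤ leftSolution β x := Real.rpow_nonneg hx _

theorem leftSolution_le_one {x : ℝ} (hx : x ∈ Icc 0 1) : leftSolution β x ≤ 1 :=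
  Real.rpow_le_one hx.1 hx.2 (le_max_left _ _)

theorem hasDerivAt_leftSolution {x : ℝ} (hx : 0 < x) :
    HasDerivAt (leftSolution β) (leftFlux β * x ^ (-β)) x := by
  refine (Real.hasDerivAt_rpow_const (Or.inl hx.ne')).congr_deriv ?_
  rcases le_or_gt 1 β with hβ | hβ
  · rw [leftFlux_of_one_le hβ, zero_mul, zero_mul]
  · rw [leftFlux_of_lt_one hβ, show 1 - β - 1 = -β by ring]

theorem continuousOn_rpow_Ioi (r : ℝ) : ContinuousOn (fun x : ℝ => x ^ r) (Ioi 0) :=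
  fun _ hx => (Real.continuousAt_rpow_const _ _ (Or.inl (ne_of_gt hx))).continuousWithinAt

theorem intervalIntegrable_rpow_of_pos (r : ℝ) {a b : ℝ} (ha : 0 < a) (hb : 0 < b) :
    IntervalIntegrable (fun x : ℝ => x ^ r) volume a b :=
  ((continuousOn_rpow_Ioi r).mono fun _ hx => (lt_min ha hb).trans_le hx.1).intervalIntegrable

theorem hasDerivAt_rightSolution {x : ℝ} (hx : 0 < x) :
    HasDerivAt (rightSolution β) (-x ^ (-β)) x :=
  intervalIntegral.integral_hasDerivAt_left (intervalIntegrable_rpow_of_pos _ hx one_pos)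
    ((continuousOn_rpow_Ioi _).stronglyMeasurableAtFilter isOpen_Ioi x hx)
    (Real.continuousAt_rpow_const _ _ (Or.inl hx.ne'))

theorem continuousOn_rightSolution : ContinuousOn (rightSolution β) (Ioi 0) :=
  fun _ hx => (hasDerivAt_rightSolution hx).continuousAt.continuousWithinAt

theorem rightSolution_one : rightSolution β 1 = 0 := intervalIntegral.integral_same

theorem antitoneOn_rightSolution : AntitoneOn (rightSolution β) (Ioi 0) :=
  antitoneOn_of_deriv_nonpos (convex_Ioi 0) continuousOn_rightSolution
    (fun x hx => (hasDerivAt_rightSolution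
      (interior_subset hx)).differentiableAt.differentiableWithinAt)
    fun x hx => by
      have hx0 : 0 < x := interior_subset hx
      rw [(hasDerivAt_rightSolution hx0).deriv]
      exact neg_nonpos.2 (Real.rpow_nonneg hx0.le _)

theorem rightSolution_nonneg {x : ℝ} (hx : x ∈ Ioc 0 1) : 0 ≤ rightSolution β x :=
  rightSolution_one.symm.trans_le (antitoneOn_rightSolution hx.1 (mem_Ioi.2 one_pos) hx.2)

theorem leftSolution_add_rightSolution (x : ℝ) :
    leftSolution β x + leftFlux β * rightSolution β x = 1 := by
  rcases le_or_gt 1 β with hβ | hβ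
  · rw [leftSolution, leftFlux_of_one_le hβ, Real.rpow_zero, zero_mul, add_zero]
  · rw [leftSolution, rightSolution, leftFlux_of_lt_one hβ,
      integral_rpow (Or.inl (by linarith)), Real.one_rpow, neg_add_eq_sub]
    field_simp [(sub_pos.2 hβ).ne']
    ring

theorem rightSolution_le_rpow_div {γ : ℝ} (hγ : 1 < γ) (hβ : β ≤ γ) {x : ℝ} (hx : x ∈ Ioc 0 1) :
    rightSolution β x ≤ x ^ (1 - γ) / (γ - 1) := by
  have mono : rightSolution β x ≤ rightSolution γ x :=
    intervalIntegral.integral_mono_on hx.2 (intervalIntegrable_rpow_of_pos _ hx.1 one_pos)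
      (intervalIntegrable_rpow_of_pos _ hx.1 one_pos) fun t ht =>
      Real.rpow_le_rpow_of_exponent_ge (hx.1.trans_le ht.1) ht.2 (neg_le_neg hβ)
  refine mono.trans ?_
  rw [rightSolution, integral_rpow (Or.inr ⟨by linarith, notMem_uIcc_of_lt hx.1 one_pos⟩),
    Real.one_rpow, neg_add_eq_sub, ← neg_div_neg_eq, neg_sub, neg_sub]
  gcongr
  linarith

theorem integrableOn_rightSolution (hβ : β < 2) : IntegrableOn (rightSolution β) (Ioo 0 1) := by
  obtain ⟨γ, hγ, hγ2⟩ := exists_between (max_lt one_lt_two hβ)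
  have integrable : IntegrableOn (fun x : ℝ => x ^ (1 - γ) / (γ - 1)) (Ioo 0 1) :=
    ((intervalIntegral.integrableOn_Ioo_rpow_iff one_pos).2 (by linarith)).div_const _
  refine integrable.mono' ((continuousOn_rightSolution.mono
    Ioo_subset_Ioi_self).aestronglyMeasurable measurableSet_Ioo) ?_
  filter_upwards [ae_restrict_mem measurableSet_Ioo] with x hx
  rw [Real.norm_of_nonneg (rightSolution_nonneg (Ioo_subset_Ioc_self hx))]
  exact rightSolution_le_rpow_div ((le_max_left _ _).trans_lt hγ) ((le_max_right _ _).trans hγ.le)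
    (Ioo_subset_Ioc_self hx)

/-! ### Green's function -/

/-- Green's function of `-(x ^ β u')' = f` with the boundary conditions of `D(A)`. -/
noncomputable def green (β x y : ℝ) : ℝ :=
  leftSolution β (min x y) * rightSolution β (max x y)

/-- The solution `∫ G(x, y) f(y) dy` of `-(x ^ β u')' = f` with the boundary conditions of
`D(A)`. -/
noncomputable def greenFun (β : ℝ) (f : ℝ → ℝ) : ℝ → ℝ :=
  kernelFun (volume.restrict (Ioo 0 1)) (green β) f

theorem green_comm (β x y : ℝ) : green β x y = green β y x := by
  rw [green, green, min_comm, max_comm]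

theorem abs_green_le_right {x y : ℝ} (hx : x ∈ Icc 0 1) (hy : y ∈ Ioo 0 1) :
    |green β x y| ≤ rightSolution β y := by
  have max_pos : 0 < max x y := hy.1.trans_le (le_max_right _ _)
  have min_nonneg : 0 ≤ min x y := le_min hx.1 hy.1.le
  have right_nonneg : 0 ≤ rightSolution β (max x y) :=
    rightSolution_nonneg ⟨max_pos, max_le hx.2 hy.2.le⟩
  rw [green, abs_of_nonneg (mul_nonneg (leftSolution_nonneg min_nonneg) right_nonneg)]
  exact (mul_le_of_le_one_left right_nonneg
    (leftSolution_le_one ⟨min_nonneg, (min_le_left _ _).trans hx.2⟩)).trans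
    (antitoneOn_rightSolution hy.1 max_pos (le_max_right _ _))

theorem abs_green_le_left {x y : ℝ} (hx : x ∈ Ioo 0 1) (hy : y ∈ Icc 0 1) :
    |green β x y| ≤ rightSolution β x :=
  green_comm β x y ▸ abs_green_le_right hy hx

theorem abs_green_le_sqrt_mul_sqrt {x y : ℝ} (hx : x ∈ Ioo 0 1) (hy : y ∈ Ioo 0 1) :
    |green β x y| ≤ √(rightSolution β x) * √(rightSolution β y) := by
  rw [← Real.sqrt_mul (rightSolution_nonneg (Ioo_subset_Ioc_self hx))]
  refine Real.le_sqrt_of_sq_le ?_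
  rw [sq]
  exact mul_le_mul (abs_green_le_left hx (Ioo_subset_Icc_self hy))
    (abs_green_le_right (Ioo_subset_Icc_self hx) hy) (abs_nonneg _)
    (rightSolution_nonneg (Ioo_subset_Ioc_self hx))

theorem memLp_sqrt_rightSolution (hβ : β < 2) :
    MemLp (fun x => √(rightSolution β x)) 2 (volume.restrict (Ioo 0 1)) := by
  have meas := (integrableOn_rightSolution hβ).1.aemeasurable.sqrt.aestronglyMeasurable
  refine (memLp_two_iff_integrable_sq meas).2 ((integrableOn_rightSolution hβ).congr ?_)
  filter_upwards [ae_restrict_mem measurableSet_Ioo] with x hx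
  exact (Real.sq_sqrt (rightSolution_nonneg (Ioo_subset_Ioc_self hx))).symm

theorem continuousOn_green :
    ContinuousOn (Function.uncurry (green β)) {p | 0 < max p.1 p.2} :=
  (continuous_leftSolution.comp (continuous_fst.min continuous_snd)).continuousOn.mul
    (continuousOn_rightSolution.comp (continuous_fst.max continuous_snd).continuousOn
      fun _ hp => hp)

theorem memLp_green (hβ : β < 2) : MemLp (Function.uncurry (green β)) 2
    ((volume.restrict (Ioo 0 1)).prod (volume.restrict (Ioo 0 1))) := by
  rw [Measure.prod_restrict]
  have measurable_square : MeasurableSet (Ioo (0 : ℝ) 1 ×ˢ Ioo (0 : ℝ) 1) :=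
    measurableSet_Ioo.prod measurableSet_Ioo
  have meas : AEStronglyMeasurable (Function.uncurry (green β))
      ((volume.prod volume).restrict (Ioo 0 1 ×ˢ Ioo 0 1)) :=
    (continuousOn_green.mono fun p hp => lt_max_of_lt_left hp.1.1).aestronglyMeasurable
      measurable_square
  refine (memLp_two_iff_integrable_sq meas).2 (Integrable.mono' (g := fun p : ℝ × ℝ =>
    rightSolution β p.1 * rightSolution β p.2) ?_ (meas.pow 2) ?_)
  · rw [← Measure.prod_restrict]
    exact (integrableOn_rightSolution hβ).mul_prod (integrableOn_rightSolution hβ)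
  · filter_upwards [ae_restrict_mem measurable_square] with p hp
    rw [norm_pow, sq]
    exact mul_le_mul (abs_green_le_left hp.1 (Ioo_subset_Icc_self hp.2))
      (abs_green_le_right (Ioo_subset_Icc_self hp.1) hp.2) (abs_nonneg _)
      (rightSolution_nonneg (Ioo_subset_Ioc_self hp.1))

theorem continuousOn_greenFun (hβ : β < 2) {f : ℝ → ℝ}
    (hf : AEStronglyMeasurable f (volume.restrict (Ioo 0 1))) {M : ℝ}
    (hM : ∀ᵐ y ∂volume.restrict (Ioo 0 1), ‖f y‖ ≤ M) :
    ContinuousOn (greenFun β f) (Icc 0 1) := by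
  refine continuousOn_of_dominated (bound := fun y => rightSolution β y * M) (fun x _ => ?_)
    (fun x hx => ?_) ((integrableOn_rightSolution hβ).mul_const M) ?_
  · refine AEStronglyMeasurable.mul ?_ hf
    exact (continuousOn_green.comp (Continuous.prodMk_right x).continuousOn
      fun y hy => lt_max_of_lt_right hy.1).aestronglyMeasurable measurableSet_Ioo
  · filter_upwards [hM, ae_restrict_mem measurableSet_Ioo] with y hfy hy
    rw [norm_mul]
    exact mul_le_mul (abs_green_le_right hx hy) hfy (norm_nonneg _)
      (rightSolution_nonneg (Ioo_subset_Ioc_self hy))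
  · filter_upwards [ae_restrict_mem measurableSet_Ioo] with y hy
    exact (continuousOn_green.comp (Continuous.prodMk_left y).continuousOn
      fun x _ => lt_max_of_lt_right hy.1).mul_const _

theorem greenFun_one (β : ℝ) (f : ℝ → ℝ) : greenFun β f 1 = 0 := by
  refine setIntegral_eq_zero_of_forall_eq_zero fun y hy => ?_
  rw [green, max_eq_left hy.2.le, rightSolution_one, mul_zero, zero_mul]

theorem greenFun_zero (hβ : β < 1) (f : ℝ → ℝ) : greenFun β f 0 = 0 := by
  refine setIntegral_eq_zero_of_forall_eq_zero fun y hy => ?_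
  rw [green, min_eq_left hy.1.le, leftSolution_zero hβ, zero_mul, zero_mul]

section ContinuousRightHandSide

variable {f : ℝ → ℝ} {x : ℝ}

theorem intervalIntegrable_leftSolution_mul (hf : ContinuousOn f (Icc 0 1)) :
    IntervalIntegrable (fun y => leftSolution β y * f y) volume 0 1 :=
  (continuous_leftSolution.continuousOn.mul hf).intervalIntegrable_of_Icc zero_le_one

theorem intervalIntegrable_rightSolution_mul (hβ : β < 2) (hf : ContinuousOn f (Icc 0 1)) :
    IntervalIntegrable (fun y => rightSolution β y * f y) volume 0 1 :=
  ((intervalIntegrable_iff_integrableOn_Ioo_of_le zero_le_one).2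
    (integrableOn_rightSolution hβ)).mul_continuousOn (by rwa [uIcc_of_le zero_le_one])

theorem greenFun_eq_add (hf : ContinuousOn f (Icc 0 1)) (hx : x ∈ Ioo 0 1) :
    greenFun β f x = rightSolution β x * (∫ y in 0..x, leftSolution β y * f y)
      + leftSolution β x * ∫ y in x..1, rightSolution β y * f y := by
  have continuousOn : ContinuousOn (fun y => green β x y * f y) (Icc 0 1) :=
    (continuousOn_green.comp (Continuous.prodMk_right x).continuousOn
      fun _ _ => lt_max_of_lt_left hx.1).mul hf
  have left : IntervalIntegrable (fun y => green β x y * f y) volume 0 x :=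
    (continuousOn.mono (Icc_subset_Icc_right hx.2.le)).intervalIntegrable_of_Icc hx.1.le
  have right : IntervalIntegrable (fun y => green β x y * f y) volume x 1 :=
    (continuousOn.mono (Icc_subset_Icc_left hx.1.le)).intervalIntegrable_of_Icc hx.2.le
  rw [greenFun, kernelFun, ← integral_Ioc_eq_integral_Ioo,
    ← intervalIntegral.integral_of_le zero_le_one,
    ← intervalIntegral.integral_add_adjacent_intervals left right,
    ← intervalIntegral.integral_const_mul, ← intervalIntegral.integral_const_mul]
  congr 1 <;> refine intervalIntegral.integral_congr fun y hy => ?_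
  · rw [uIcc_of_le hx.1.le] at hy
    simp only [green, min_eq_right hy.2, max_eq_left hy.2]
    ring
  · rw [uIcc_of_le hx.2.le] at hy
    simp only [green, min_eq_left hy.1, max_eq_right hy.1]
    ring

/-- The flux of `greenFun β f`, as a function that is continuous up to the boundary. -/
noncomputable def greenFlux (β : ℝ) (f : ℝ → ℝ) (x : ℝ) : ℝ :=
  leftFlux β * (∫ y in x..1, rightSolution β y * f y) - ∫ y in 0..x, leftSolution β y * f y

theorem greenFlux_zero (hβ : 1 ≤ β) (f : ℝ → ℝ) : greenFlux β f 0 = 0 := by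
  rw [greenFlux, leftFlux_of_one_le hβ, zero_mul, intervalIntegral.integral_same, sub_zero]

theorem continuousOn_greenFlux (hβ : β < 2) (hf : ContinuousOn f (Icc 0 1)) :
    ContinuousOn (greenFlux β f) (Icc 0 1) := by
  have left := intervalIntegral.continuousOn_primitive_interval'
    (intervalIntegrable_leftSolution_mul (β := β) hf) left_mem_uIcc
  have right := intervalIntegral.continuousOn_primitive_interval'
    (intervalIntegrable_rightSolution_mul hβ hf) right_mem_uIcc
  rw [uIcc_of_le zero_le_one] at left right
  refine ((right.neg.congr fun x _ => ?_).const_mul (leftFlux β)).sub left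
  exact intervalIntegral.integral_symm _ _

theorem hasDerivAt_integral_leftSolution_mul (hf : ContinuousOn f (Icc 0 1)) (hx : x ∈ Ioo 0 1) :
    HasDerivAt (fun x => ∫ y in 0..x, leftSolution β y * f y) (leftSolution β x * f x) x :=
  hasDerivAt_integral_right_of_continuousOn_Ioo (intervalIntegrable_leftSolution_mul hf)
    (continuous_leftSolution.continuousOn.mul (hf.mono Ioo_subset_Icc_self)) hx

theorem hasDerivAt_integral_rightSolution_mul (hβ : β < 2) (hf : ContinuousOn f (Icc 0 1))
    (hx : x ∈ Ioo 0 1) :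
    HasDerivAt (fun x => ∫ y in x..1, rightSolution β y * f y) (-(rightSolution β x * f x)) x :=
  hasDerivAt_integral_left_of_continuousOn_Ioo (intervalIntegrable_rightSolution_mul hβ hf)
    ((continuousOn_rightSolution.mono Ioo_subset_Ioi_self).mul (hf.mono Ioo_subset_Icc_self)) hx

theorem hasDerivAt_greenFlux (hβ : β < 2) (hf : ContinuousOn f (Icc 0 1)) (hx : x ∈ Ioo 0 1) :
    HasDerivAt (greenFlux β f) (-f x) x :=
  (((hasDerivAt_integral_rightSolution_mul hβ hf hx).const_mul _).sub
    (hasDerivAt_integral_leftSolution_mul hf hx)).congr_deriv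
    (by linear_combination (-f x) * leftSolution_add_rightSolution (β := β) x)

theorem hasDerivAt_greenFun (hβ : β < 2) (hf : ContinuousOn f (Icc 0 1)) (hx : x ∈ Ioo 0 1) :
    HasDerivAt (greenFun β f) (x ^ (-β) * greenFlux β f x) x := by
  have left := (hasDerivAt_rightSolution (β := β) hx.1).mul
    (hasDerivAt_integral_leftSolution_mul (β := β) hf hx)
  have right := (hasDerivAt_leftSolution (β := β) hx.1).mul
    (hasDerivAt_integral_rightSolution_mul hβ hf hx)
  refine ((left.add right).congr_deriv ?_).congr_of_eventuallyEq ?_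
  · rw [greenFlux]
    ring
  · filter_upwards [Ioo_mem_nhds hx.1 hx.2] with y hy using greenFun_eq_add hf hy

theorem eqOn_flux_greenFun (hβ : β < 2) (hf : ContinuousOn f (Icc 0 1)) :
    EqOn (greenFlux β f) (flux β (greenFun β f)) (Ioo 0 1) := fun x hx => by
  rw [flux, (hasDerivAt_greenFun hβ hf hx).deriv, Real.rpow_neg hx.1.le,
    mul_inv_cancel_left₀ (Real.rpow_pos_of_pos hx.1 β).ne']

theorem hasDerivAt_flux_greenFun (hβ : β < 2) (hf : ContinuousOn f (Icc 0 1))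
    (hx : x ∈ Ioo 0 1) : HasDerivAt (flux β (greenFun β f)) (-f x) x := by
  refine (hasDerivAt_greenFlux hβ hf hx).congr_of_eventuallyEq ?_
  filter_upwards [Ioo_mem_nhds hx.1 hx.2] with y hy using (eqOn_flux_greenFun hβ hf hy).symm

theorem diffExpr_greenFun (hβ : β < 2) (hf : ContinuousOn f (Icc 0 1)) (hx : x ∈ Ioo 0 1) :
    diffExpr β (greenFun β f) x = f x := by
  rw [diffExpr, (hasDerivAt_flux_greenFun hβ hf hx).deriv, neg_neg]

theorem continuousOn_greenFun_of_continuousOn (hβ : β < 2) (hf : ContinuousOn f (Icc 0 1)) :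
    ContinuousOn (greenFun β f) (Icc 0 1) := by
  obtain ⟨M, hM⟩ := isCompact_Icc.exists_bound_of_continuousOn hf
  refine continuousOn_greenFun hβ
    ((hf.mono Ioo_subset_Icc_self).aestronglyMeasurable measurableSet_Ioo) (M := M) ?_
  filter_upwards [ae_restrict_mem measurableSet_Ioo] with y hy using hM y (Ioo_subset_Icc_self hy)

theorem inDomain_greenFun (hβ : β < 2) (hf : AbsolutelyContinuousOnInterval f 0 1) :
    InDomain β (greenFun β f) := by
  have hc : ContinuousOn f (Icc 0 1) := by simpa only [uIcc_of_le zero_le_one] using hf.continuousOn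
  exact
    { continuousOn := continuousOn_greenFun_of_continuousOn hβ hc
      differentiableAt := fun x hx => (hasDerivAt_greenFun hβ hc hx).differentiableAt
      flux_continuous := ⟨greenFlux β f, continuousOn_greenFlux hβ hc, eqOn_flux_greenFun hβ hc⟩
      deriv_flux := ⟨-f, hf.neg, fun x hx => hasDerivAt_flux_greenFun hβ hc hx⟩
      right_boundary := greenFun_one β f
      left_boundary := fun h => greenFun_zero h f }

end ContinuousRightHandSide

theorem intervalIntegrable_rpow_neg_mul (hβ : β < 2) {F g : ℝ → ℝ}
    (hF : ContinuousOn F (Icc 0 1)) (hd : ∀ x ∈ Ioo (0 : ℝ) 1, HasDerivAt F (g x) x)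
    (hg : ContinuousOn g (Icc 0 1)) (h0 : 1 ≤ β → F 0 = 0) :
    IntervalIntegrable (fun x => x ^ (-β) * F x) volume 0 1 := by
  rcases lt_or_ge β 1 with h | h
  · exact (intervalIntegral.intervalIntegrable_rpow' (neg_lt_neg h)).mul_continuousOn
      (by rwa [uIcc_of_le zero_le_one])
  obtain ⟨M, hM⟩ := isCompact_Icc.exists_bound_of_continuousOn hg
  have norm_le : ∀ x ∈ Ioo (0 : ℝ) 1, ‖F x‖ ≤ M * x := fun x hx => by
    have hsub : Icc 0 x ⊆ Icc 0 1 := Icc_subset_Icc_right hx.2.le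
    have ftc := intervalIntegral.integral_eq_sub_of_hasDerivAt_of_le hx.1.le (hF.mono hsub)
      (fun t ht => hd t ⟨ht.1, ht.2.trans hx.2⟩)
      ((hg.mono hsub).intervalIntegrable_of_Icc hx.1.le)
    rw [h0 h, sub_zero] at ftc
    rw [← ftc]
    refine (intervalIntegral.norm_integral_le_of_norm_le_const fun t ht => ?_).trans_eq
      (by rw [sub_zero, abs_of_pos hx.1])
    rw [uIoc_of_le hx.1.le] at ht
    exact hM t (hsub (Ioc_subset_Icc_self ht))
  rw [intervalIntegrable_iff_integrableOn_Ioo_of_le zero_le_one]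
  have integrable : IntegrableOn (fun x : ℝ => M * x ^ (1 - β)) (Ioo 0 1) :=
    ((intervalIntegral.integrableOn_Ioo_rpow_iff one_pos).2 (by linarith)).const_mul M
  refine integrable.mono' ((((continuousOn_rpow_Ioi _).mono Ioo_subset_Ioi_self).mul
    (hF.mono Ioo_subset_Icc_self)).aestronglyMeasurable measurableSet_Ioo) ?_
  filter_upwards [ae_restrict_mem measurableSet_Ioo] with x hx
  calc ‖x ^ (-β) * F x‖ ≤ x ^ (-β) * (M * x) := by
        rw [norm_mul, Real.norm_of_nonneg (Real.rpow_nonneg hx.1.le _)]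
        exact mul_le_mul_of_nonneg_left (norm_le x hx) (Real.rpow_nonneg hx.1.le _)
    _ = M * x ^ (1 - β) := by
        rw [show 1 - β = -β + 1 by ring, Real.rpow_add_one hx.1.ne']
        ring

theorem intervalIntegrable_rpow_neg_mul_greenFlux (hβ : β < 2) {f : ℝ → ℝ}
    (hf : ContinuousOn f (Icc 0 1)) :
    IntervalIntegrable (fun x => x ^ (-β) * greenFlux β f x) volume 0 1 :=
  intervalIntegrable_rpow_neg_mul hβ (continuousOn_greenFlux hβ hf)
    (fun _ hx => hasDerivAt_greenFlux hβ hf hx) hf.neg fun h => greenFlux_zero h f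

theorem absolutelyContinuousOnInterval_greenFun (hβ : β < 2) {f : ℝ → ℝ}
    (hf : ContinuousOn f (Icc 0 1)) : AbsolutelyContinuousOnInterval (greenFun β f) 0 1 :=
  absolutelyContinuousOnInterval_of_hasDerivAt zero_le_one
    (continuousOn_greenFun_of_continuousOn hβ hf) (fun _ hx => hasDerivAt_greenFun hβ hf hx)
    (intervalIntegrable_rpow_neg_mul_greenFlux hβ hf)

/-! ### Green's formula -/

namespace InDomain

variable {u v : ℝ → ℝ} {x : ℝ}

theorem hasDerivAt (hv : InDomain β v) (hx : x ∈ Ioo 0 1) :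
    HasDerivAt v (x ^ (-β) * flux β v x) x := by
  rw [flux, Real.rpow_neg hx.1.le, inv_mul_cancel_left₀ (Real.rpow_pos_of_pos hx.1 β).ne']
  exact (hv.differentiableAt x hx).hasDerivAt

theorem exists_absolutelyContinuous_eqOn_diffExpr (hv : InDomain β v) :
    ∃ f, AbsolutelyContinuousOnInterval f 0 1 ∧ EqOn f (diffExpr β v) (Ioo 0 1) := by
  obtain ⟨g, hg, hd⟩ := hv.deriv_flux
  exact ⟨-g, hg.neg, fun x hx => by rw [diffExpr, (hd x hx).deriv, Pi.neg_apply]⟩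

theorem flux_zero {w : ℝ → ℝ} (hv : InDomain β v) (hβ : 1 ≤ β) (hw : ContinuousOn w (Icc 0 1))
    (hf : EqOn w (flux β v) (Ioo 0 1)) : w 0 = 0 := by
  have hn := hv.smul (-1)
  refine le_antisymm (flux_zero_le hβ hv.continuousOn hv.differentiableAt hw hf) ?_
  refine neg_nonpos.1 (flux_zero_le (w := fun x => -w x) hβ hn.continuousOn hn.differentiableAt
    hw.neg fun x hx => ?_)
  rw [flux_smul, ← hf hx, neg_one_mul]

theorem exists_flux_extension (hu : InDomain β u) :
    ∃ w, ContinuousOn w (Icc 0 1) ∧ EqOn w (flux β u) (Ioo 0 1) ∧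
      (∀ x ∈ Ioo (0 : ℝ) 1, HasDerivAt w (-diffExpr β u x) x) ∧
      ∀ {v}, InDomain β v → w 0 * v 0 = 0 := by
  obtain ⟨w, hw, hf⟩ := hu.flux_continuous
  obtain ⟨g, -, hd⟩ := hu.deriv_flux
  refine ⟨w, hw, hf, fun x hx => ?_, fun hv => ?_⟩
  · rw [diffExpr, neg_neg, (hd x hx).deriv]
    refine (hd x hx).congr_of_eventuallyEq ?_
    filter_upwards [Ioo_mem_nhds hx.1 hx.2] with y hy using hf hy
  · rcases lt_or_ge β 1 with h | h
    · rw [hv.left_boundary h, mul_zero]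
    · rw [hu.flux_zero h hw hf, zero_mul]

theorem eqOn_zero (hu : InDomain β u) (h : ∀ x ∈ Ioo (0 : ℝ) 1, diffExpr β u x = 0) :
    EqOn u 0 (Ioo 0 1) := by
  obtain ⟨w, hw, hf, hd, hw0⟩ := hu.exists_flux_extension
  have hasDerivAt_mul : ∀ x ∈ Ioo (0 : ℝ) 1,
      HasDerivAt (fun x => w x * u x) (x ^ (-β) * flux β u x ^ 2) x := fun x hx =>
    ((hd x hx).mul (hu.hasDerivAt hx)).congr_deriv (by rw [h x hx, hf hx]; ring)
  have monotone : MonotoneOn (fun x => w x * u x) (Icc 0 1) := by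
    refine monotoneOn_of_hasDerivWithinAt_nonneg (convex_Icc 0 1) (hw.mul hu.continuousOn)
      (f' := fun x => x ^ (-β) * flux β u x ^ 2) (fun x hx => ?_) (fun x hx => ?_) <;>
      rw [interior_Icc] at hx
    · exact (hasDerivAt_mul x hx).hasDerivWithinAt
    · exact mul_nonneg (Real.rpow_nonneg hx.1.le _) (sq_nonneg _)
  have mul_eq_zero : EqOn (fun x => w x * u x) 0 (Ioo 0 1) := fun x hx => by
    have left := monotone (left_mem_Icc.2 zero_le_one) (Ioo_subset_Icc_self hx) hx.1.le
    have right := monotone (Ioo_subset_Icc_self hx) (right_mem_Icc.2 zero_le_one) hx.2.le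
    simp only [hw0 hu, hu.right_boundary, mul_zero] at left right
    exact le_antisymm right left
  have deriv_eq_zero : ∀ x ∈ Ioo (0 : ℝ) 1, deriv u x = 0 := fun x hx => by
    have := (hasDerivAt_mul x hx).unique ((hasDerivAt_const x (0 : ℝ)).congr_of_eventuallyEq
      (mul_eq_zero.eventuallyEq_of_mem (Ioo_mem_nhds hx.1 hx.2)))
    have hx0 := fun r => (Real.rpow_pos_of_pos hx.1 r).ne'
    simpa [flux, hx0] using this
  intro x hx
  obtain ⟨y, hy, slope⟩ := exists_deriv_eq_slope u hx.2
    (hu.continuousOn.mono (Icc_subset_Icc_left hx.1.le)) fun y hy =>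
      (hu.differentiableAt y ⟨hx.1.trans hy.1, hy.2⟩).differentiableWithinAt
  rw [deriv_eq_zero y ⟨hx.1.trans hy.1, hy.2⟩, hu.right_boundary, zero_sub, eq_comm,
    div_eq_zero_iff, neg_eq_zero] at slope
  exact slope.resolve_right (sub_pos.2 hx.2).ne'

theorem exists_eqOn_greenFun (hβ : β < 2) (hv : InDomain β v) :
    ∃ f, ContinuousOn f (Icc 0 1) ∧ EqOn f (diffExpr β v) (Ioo 0 1) ∧
      EqOn v (greenFun β f) (Ioo 0 1) := by
  obtain ⟨f, hf, hfv⟩ := hv.exists_absolutelyContinuous_eqOn_diffExpr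
  have hc : ContinuousOn f (Icc 0 1) := by simpa only [uIcc_of_le zero_le_one] using hf.continuousOn
  have hG := inDomain_greenFun hβ hf
  refine ⟨f, hc, hfv, fun x hx => ?_⟩
  refine sub_eq_zero.1 ?_
  have diff_eq_zero := (hv.add (hG.smul (-1))).eqOn_zero (fun y hy => by
    rw [hv.diffExpr_add (hG.smul (-1)) hy, hG.diffExpr_smul _ hy, diffExpr_greenFun hβ hc hy,
      hfv hy, neg_one_mul, add_neg_cancel]) hx
  rwa [Pi.add_apply, Pi.smul_apply, neg_one_smul, ← sub_eq_add_neg] at diff_eq_zero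

theorem eqOn_greenFun (hβ : β < 2) (hv : InDomain β v) :
    EqOn v (greenFun β (diffExpr β v)) (Ioo 0 1) := by
  obtain ⟨f, -, hf, hv⟩ := hv.exists_eqOn_greenFun hβ
  refine hv.trans fun x _ => congrFun (kernelFun_congr_ae ?_) x
  filter_upwards [ae_restrict_mem measurableSet_Ioo] with y hy using hf hy

theorem intervalIntegrable_deriv (hβ : β < 2) (hv : InDomain β v) :
    IntervalIntegrable (deriv v) volume 0 1 := by
  obtain ⟨f, hf, -, hvf⟩ := hv.exists_eqOn_greenFun hβ
  have := intervalIntegrable_rpow_neg_mul_greenFlux hβ hf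
  rw [intervalIntegrable_iff_integrableOn_Ioo_of_le zero_le_one] at this ⊢
  refine this.congr_fun (fun x hx => ?_) measurableSet_Ioo
  rw [(hvf.eventuallyEq_of_mem (Ioo_mem_nhds hx.1 hx.2)).deriv_eq,
    (hasDerivAt_greenFun hβ hf hx).deriv]

theorem integrableOn_flux_mul_deriv (hβ : β < 2) (hu : InDomain β u) (hv : InDomain β v) :
    IntegrableOn (fun x => flux β u x * deriv v x) (Ioo 0 1) := by
  obtain ⟨w, hw, hf⟩ := hu.flux_continuous
  have := (hv.intervalIntegrable_deriv hβ).continuousOn_mul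
    (by rwa [uIcc_of_le zero_le_one] : ContinuousOn w (uIcc 0 1))
  rw [intervalIntegrable_iff_integrableOn_Ioo_of_le zero_le_one] at this
  exact this.congr_fun (fun x hx => by simp only [hf hx]) measurableSet_Ioo

theorem integral_flux_mul_deriv (hβ : β < 2) (hu : InDomain β u) (hv : InDomain β v) :
    ∫ x in Ioo (0 : ℝ) 1, flux β u x * deriv v x = ∫ x in Ioo (0 : ℝ) 1, diffExpr β u x * v x := by
  obtain ⟨w, hw, hwu, hd, hw0⟩ := hu.exists_flux_extension
  obtain ⟨f, hf, hfu, -⟩ := hu.exists_eqOn_greenFun hβ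
  have hcv := hv.continuousOn
  have parts : ∫ x in 0..1, w x * deriv v x =
      w 1 * v 1 - w 0 * v 0 - ∫ x in 0..1, -f x * v x := by
    rw [← uIcc_of_le zero_le_one] at hw hcv
    refine intervalIntegral.integral_mul_deriv_eq_deriv_mul_of_hasDerivAt hw hcv
      (fun x hx => ?_) (fun x hx => ?_) (hf.neg.intervalIntegrable_of_Icc zero_le_one)
      (hv.intervalIntegrable_deriv hβ) <;>
      rw [min_eq_left zero_le_one, max_eq_right zero_le_one] at hx
    · exact (hd x hx).congr_deriv (by rw [hfu hx])
    · exact (hv.differentiableAt x hx).hasDerivAt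
  simp only [hv.right_boundary, hw0 hv, neg_mul, mul_zero, sub_zero, zero_sub,
    intervalIntegral.integral_of_le zero_le_one, integral_Ioc_eq_integral_Ioo, integral_neg,
    neg_neg] at parts
  rw [setIntegral_congr_fun measurableSet_Ioo fun x hx => congrArg (· * deriv v x) (hwu hx).symm,
    parts, setIntegral_congr_fun measurableSet_Ioo fun x hx => congrArg (· * v x) (hfu hx)]

end InDomain

/-! ### The inverse of the Friedrichs extension -/

/-- The solution operator of `A u = f` on `L²(0, 1)`. -/
noncomputable def greenOperator (hβ : β < 2) : L2 →L[ℝ] L2 :=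
  kernelOperator (memLp_green hβ)

theorem greenOperator_apply_ae (hβ : β < 2) (f : L2) :
    greenOperator hβ f =ᵐ[volume.restrict (Ioo (0 : ℝ) 1)] greenFun β f :=
  kernelOperator_apply_ae (memLp_green hβ) f

theorem isHilbertSchmidt_greenOperator (hβ : β < 2) : IsHilbertSchmidt (greenOperator hβ) :=
  isHilbertSchmidt_kernelOperator (memLp_green hβ)

theorem isSymmetric_greenOperator (hβ : β < 2) :
    (greenOperator hβ : L2 →ₗ[ℝ] L2).IsSymmetric :=
  isSymmetric_kernelOperator (memLp_green hβ) fun x y => green_comm β x y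

theorem exists_inDomain_of_mem_graph {p : L2 × L2} (hp : p ∈ (operator β).graph) :
    ∃ v, InDomain β v ∧ p.1 =ᵐ[volume.restrict (Ioo (0 : ℝ) 1)] v ∧
      p.2 =ᵐ[volume.restrict (Ioo (0 : ℝ) 1)] diffExpr β v := by
  rwa [operator_graph] at hp

theorem greenOperator_operator (hβ : β < 2) (f : (operator β).domain) :
    greenOperator hβ (operator β f) = f := by
  obtain ⟨v, hv, hfv, hAfv⟩ := exists_inDomain_of_mem_graph (LinearPMap.mem_graph _ f)
  refine Lp.ext ((greenOperator_apply_ae hβ _).trans ?_)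
  filter_upwards [hfv, ae_restrict_mem measurableSet_Ioo] with x hfx hx
  rw [hfx, hv.eqOn_greenFun hβ hx, greenFun, kernelFun_congr_ae hAfv, ← greenFun]

theorem memLp_of_continuousOn {f : ℝ → ℝ} (hf : ContinuousOn f (Icc 0 1)) :
    MemLp f 2 (volume.restrict (Ioo (0 : ℝ) 1)) := by
  obtain ⟨M, hM⟩ := isCompact_Icc.exists_bound_of_continuousOn hf
  refine MemLp.of_bound ((hf.mono Ioo_subset_Icc_self).aestronglyMeasurable measurableSet_Ioo) M ?_
  filter_upwards [ae_restrict_mem measurableSet_Ioo] with y hy using hM y (Ioo_subset_Icc_self hy)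

theorem dense_of_contDiff_mem {S : Submodule ℝ L2}
    (hS : ∀ φ : ℝ → ℝ, ContDiff ℝ (⊤ : ℕ∞) φ → tsupport φ ⊆ Ioo 0 1 →
      ∃ f ∈ S, f =ᵐ[volume.restrict (Ioo (0 : ℝ) 1)] φ) : Dense (S : Set L2) := by
  rw [Submodule.dense_iff_topologicalClosure_eq_top, Submodule.topologicalClosure_eq_top_iff,
    Submodule.eq_bot_iff]
  intro f hf
  have integrable : IntegrableOn f (Ioo 0 1) := (Lp.memLp f).integrable one_le_two
  have eq_zero := isOpen_Ioo.ae_eq_zero_of_integral_contDiff_smul_eq_zero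
    integrable.locallyIntegrableOn fun φ hφ _ hsupp => by
      obtain ⟨g, hg, hgφ⟩ := hS φ hφ hsupp
      have inner_eq_zero := (Submodule.mem_orthogonal S f).1 hf g hg
      rw [L2.inner_def] at inner_eq_zero
      rw [← setIntegral_eq_integral_of_forall_compl_eq_zero (s := Ioo (0 : ℝ) 1)
        fun x hx => by rw [image_eq_zero_of_notMem_tsupport fun h => hx (hsupp h), zero_smul]]
      refine (integral_congr_ae ?_).trans inner_eq_zero
      filter_upwards [hgφ] with x hx
      rw [hx, smul_eq_mul, RCLike.inner_apply', conj_trivial]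
  exact Lp.ext (EventuallyEq.trans ((ae_restrict_iff' measurableSet_Ioo).2 eq_zero)
    (Lp.coeFn_zero _ _ _).symm)

theorem dense_greenOperator_mem_graph (hβ : β < 2) :
    Dense {f : L2 | (greenOperator hβ f, f) ∈ (operator β).graph} := by
  rw [operator_graph]
  refine dense_of_contDiff_mem
    (S := (graph β).comap ((greenOperator hβ : L2 →ₗ[ℝ] L2).prod LinearMap.id)) fun φ hφ _ => ?_
  have hc : ContinuousOn φ (Icc 0 1) := hφ.continuous.continuousOn
  have hm := memLp_of_continuousOn hc
  have hac : AbsolutelyContinuousOnInterval φ 0 1 :=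
    (hφ.of_le (by exact_mod_cast le_top)).contDiffOn.absolutelyContinuousOnInterval
  refine ⟨hm.toLp, ⟨greenFun β φ, inDomain_greenFun hβ hac, ?_, ?_⟩, hm.coeFn_toLp⟩
  · exact (greenOperator_apply_ae hβ _).trans (.of_eq (kernelFun_congr_ae hm.coeFn_toLp))
  · refine hm.coeFn_toLp.trans ?_
    filter_upwards [ae_restrict_mem measurableSet_Ioo] with x hx
    rw [diffExpr_greenFun hβ hc hx]

section CompactSupport

variable {φ : ℝ → ℝ}

theorem contDiff_flux (hφ : ContDiff ℝ (⊤ : ℕ∞) φ) (hs : tsupport φ ⊆ Ioo 0 1) :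
    ContDiff ℝ (⊤ : ℕ∞) (flux β φ) := by
  refine contDiff_iff_contDiffAt.2 fun x => ?_
  by_cases hx : x ∈ tsupport (deriv φ)
  · exact (Real.contDiffAt_rpow_const_of_ne (hs (tsupport_deriv_subset hx)).1.ne').mul
      (contDiff_infty_iff_deriv.1 hφ).2.contDiffAt
  · refine (contDiffAt_const (c := (0 : ℝ))).congr_of_eventuallyEq ?_
    filter_upwards [notMem_tsupport_iff_eventuallyEq.1 hx] with y hy
    rw [flux, hy, Pi.zero_apply, mul_zero]

theorem inDomain_of_contDiff (hφ : ContDiff ℝ (⊤ : ℕ∞) φ) (hs : tsupport φ ⊆ Ioo 0 1) :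
    InDomain β φ :=
  have flux_diff := contDiff_infty_iff_deriv.1 (contDiff_flux (β := β) hφ hs)
  { continuousOn := hφ.continuous.continuousOn
    differentiableAt := fun x _ => hφ.contDiffAt.differentiableAt (by simp)
    flux_continuous := ⟨flux β φ, flux_diff.1.continuous.continuousOn, fun _ _ => rfl⟩
    deriv_flux := ⟨deriv (flux β φ),
      (flux_diff.2.of_le (by exact_mod_cast le_top)).contDiffOn.absolutelyContinuousOnInterval,
      fun x _ => (flux_diff.1 x).hasDerivAt⟩
    right_boundary := image_eq_zero_of_notMem_tsupport fun h => lt_irrefl _ (hs h).2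
    left_boundary := fun _ => image_eq_zero_of_notMem_tsupport fun h => lt_irrefl _ (hs h).1 }

end CompactSupport

theorem dense_domain_operator : Dense ((operator β).domain : Set L2) := by
  refine dense_of_contDiff_mem fun φ hφ hs => ?_
  have hm := memLp_of_continuousOn (f := φ) hφ.continuous.continuousOn
  have hd := memLp_of_continuousOn (f := diffExpr β φ)
    (contDiff_infty_iff_deriv.1 (contDiff_flux hφ hs)).2.continuous.neg.continuousOn
  refine ⟨hm.toLp, LinearPMap.mem_domain_of_mem_graph (y := hd.toLp) ?_, hm.coeFn_toLp⟩
  rw [operator_graph]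
  exact ⟨φ, inDomain_of_contDiff hφ hs, hm.coeFn_toLp, hd.coeFn_toLp⟩

theorem isBoundedInverse_greenOperator (hβ : β < 2) :
    IsBoundedInverse (friedrichs β) (greenOperator hβ) :=
  isBoundedInverse_friedrichsExtension _ dense_domain_operator (isSymmetric_greenOperator hβ)
    (greenOperator_operator hβ) (dense_greenOperator_mem_graph hβ)

theorem not_mem_domain_operator_of_ae_eq_one {f : L2}
    (hf : f =ᵐ[volume.restrict (Ioo (0 : ℝ) 1)] 1) : f ∉ (operator β).domain := fun hmem => by
  obtain ⟨v, hv, hfv, -⟩ := exists_inDomain_of_mem_graph (LinearPMap.mem_graph _ ⟨f, hmem⟩)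
  have ae_eq := hfv.symm.trans hf
  rw [restrict_Ioo_eq_restrict_Icc] at ae_eq
  have eq_one := Measure.eqOn_Icc_of_ae_eq volume zero_ne_one ae_eq hv.continuousOn
    continuousOn_const (right_mem_Icc.2 zero_le_one)
  exact zero_ne_one (hv.right_boundary.symm.trans eq_one)

theorem not_finiteDimensional_L2 : ¬FiniteDimensional ℝ L2 := fun _ => by
  have domain_eq_top : (operator 0).domain = ⊤ :=
    SetLike.coe_injective ((Submodule.closed_of_finiteDimensional _).closure_eq.symm.trans
      dense_domain_operator.closure_eq)
  have one_memLp := memLp_of_continuousOn (f := 1) continuousOn_const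
  exact not_mem_domain_operator_of_ae_eq_one one_memLp.coeFn_toLp
    (domain_eq_top ▸ Submodule.mem_top (x := one_memLp.toLp))

/-! ### Eigenfunctions -/

section Eigenfunctions

variable {f g : L2} {lam : ℝ}

theorem ae_eq_mul_greenFun_of_mem_eigenspace (hβ : β < 2) (hlam : lam ≠ 0)
    (hf : f ∈ (friedrichs β).eigenspace lam) :
    f =ᵐ[volume.restrict (Ioo (0 : ℝ) 1)] fun x => lam * greenFun β f x := by
  have hKf : lam • greenOperator hβ f = f := by
    rw [((isBoundedInverse_greenOperator hβ).mem_eigenspace_iff hlam).1 hf, smul_inv_smul₀ hlam]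
  have smul_ae := Lp.coeFn_smul lam (greenOperator hβ f)
  rw [hKf] at smul_ae
  filter_upwards [smul_ae, greenOperator_apply_ae hβ f] with x hsmul hgreen
  rw [hsmul, Pi.smul_apply, hgreen, smul_eq_mul]

theorem exists_ae_norm_le_of_ae_eq_mul_greenFun (hβ : β < 2)
    (hf : f =ᵐ[volume.restrict (Ioo (0 : ℝ) 1)] fun x => lam * greenFun β f x) :
    ∃ M, ∀ᵐ x ∂volume.restrict (Ioo (0 : ℝ) 1), ‖f x‖ ≤ M := by
  refine exists_ae_norm_le_of_eq_mul_kernelFun (fun x => Real.sqrt_nonneg (rightSolution β x))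
    (memLp_sqrt_rightSolution hβ) ?_ (Lp.memLp f) hf
  filter_upwards [ae_restrict_mem measurableSet_Ioo] with x hx
  filter_upwards [ae_restrict_mem measurableSet_Ioo] with y hy
  rw [Real.sq_sqrt (rightSolution_nonneg (Ioo_subset_Ioc_self hy))]
  exact ⟨abs_green_le_sqrt_mul_sqrt hx hy, abs_green_le_right (Ioo_subset_Icc_self hx) hy⟩

theorem exists_inDomain_of_mem_eigenspace (hβ : β < 2) (hlam : lam ≠ 0)
    (hf : f ∈ (friedrichs β).eigenspace lam) :
    ∃ v, f =ᵐ[volume.restrict (Ioo (0 : ℝ) 1)] v ∧ InDomain β v ∧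
      ∀ x ∈ Ioo (0 : ℝ) 1, diffExpr β v x = lam * v x := by
  have hfG := ae_eq_mul_greenFun_of_mem_eigenspace hβ hlam hf
  obtain ⟨M, hM⟩ := exists_ae_norm_le_of_ae_eq_mul_greenFun hβ hfG
  set v := fun x => lam * greenFun β f x with v_def
  have continuous_smul : ContinuousOn (fun x => lam * v x) (Icc 0 1) :=
    ((continuousOn_greenFun hβ (Lp.aestronglyMeasurable f) hM).const_mul lam).const_mul lam
  have v_eq : v = greenFun β (fun x => lam * v x) := by
    rw [greenFun, ← kernelFun_congr_ae (hfG.mono fun x hx => congrArg (lam * ·) hx)]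
    funext x
    simp only [v_def, greenFun, kernelFun, ← integral_const_mul, mul_left_comm]
  have v_ac : AbsolutelyContinuousOnInterval v 0 1 :=
    v_eq ▸ absolutelyContinuousOnInterval_greenFun hβ continuous_smul
  refine ⟨v, hfG, v_eq ▸ inDomain_greenFun hβ (v_ac.const_mul lam), fun x hx => ?_⟩
  conv_lhs => rw [v_eq]
  exact diffExpr_greenFun hβ continuous_smul hx

theorem InDomain.integral_flux_mul_deriv_of_eigenfunction {u v : ℝ → ℝ} (hβ : β < 2)
    (hu : InDomain β u) (hv : InDomain β v) (hfu : f =ᵐ[volume.restrict (Ioo (0 : ℝ) 1)] u)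
    (hgv : g =ᵐ[volume.restrict (Ioo (0 : ℝ) 1)] v)
    (heq : ∀ x ∈ Ioo (0 : ℝ) 1, diffExpr β u x = lam * u x) :
    ∫ x in Ioo (0 : ℝ) 1, flux β u x * deriv v x = lam * inner ℝ f g := by
  rw [hu.integral_flux_mul_deriv hβ hv, L2.inner_def, ← integral_const_mul]
  refine integral_congr_ae ?_
  filter_upwards [hfu, hgv, ae_restrict_mem measurableSet_Ioo] with x hfx hgx hx
  rw [heq x hx, hfx, hgx, RCLike.inner_apply', conj_trivial, mul_assoc]

end Eigenfunctions

theorem integral_flux_mul_deriv_self_nonneg (β : ℝ) (v : ℝ → ℝ) :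
    0 ≤ ∫ x in Ioo (0 : ℝ) 1, flux β v x * deriv v x :=
  setIntegral_nonneg measurableSet_Ioo fun x hx => by
    rw [flux, mul_assoc]
    exact mul_nonneg (Real.rpow_nonneg hx.1.le β) (mul_self_nonneg _)

end Degenerate

theorem mainTheorem3_general (β : ℝ) (hβ : β < 2) :
    (Degenerate.friedrichs β).HasDiscreteSpectrum ∧
    ∃ (lam : ℕ → ℝ) (v : ℕ → ℝ → ℝ) (b : HilbertBasis ℕ ℝ Degenerate.L2),
      (∀ n, 0 < lam n) ∧
      Tendsto lam atTop atTop ∧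
      (Degenerate.friedrichs β).spectrum = Set.range lam ∧
      (∀ n, b n =ᵐ[volume.restrict (Ioo (0 : ℝ) 1)] v n) ∧
      (∀ n, ∃ h : b n ∈ (Degenerate.friedrichs β).domain,
        Degenerate.friedrichs β ⟨b n, h⟩ = lam n • b n) ∧
      (∀ n, Degenerate.InDomain β (v n) ∧
        ∀ x ∈ Ioo (0 : ℝ) 1, Degenerate.diffExpr β (v n) x = lam n * v n x) ∧
      (∀ i j,
        IntegrableOn (fun x => x ^ β * deriv (v i) x * deriv (v j) x) (Ioo 0 1) ∧
        ∫ x in Ioo (0 : ℝ) 1, x ^ β * deriv (v i) x * deriv (v j) x =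
          if i = j then lam i else 0) := by
  have inverse := Degenerate.isBoundedInverse_greenOperator hβ
  have compact := (Degenerate.isHilbertSchmidt_greenOperator hβ).isCompactOperator
  obtain ⟨b, lam, tendsto, spectrum_eq, eigen⟩ := inverse.exists_hilbertBasis_eigenspace
    Degenerate.not_finiteDimensional_L2 compact (Degenerate.isSymmetric_greenOperator hβ)
  choose v hbv hv hAv using fun n =>
    Degenerate.exists_inDomain_of_mem_eigenspace hβ (eigen n).1 (eigen n).2
  have energy (i j : ℕ) : ∫ x in Ioo (0 : ℝ) 1, Degenerate.flux β (v i) x * deriv (v j) x =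
      if i = j then lam i else 0 := by
    rw [(hv i).integral_flux_mul_deriv_of_eigenfunction hβ (hv j) (hbv i) (hbv j) (hAv i),
      orthonormal_iff_ite.1 b.orthonormal, mul_ite, mul_one, mul_zero]
  have pos (n : ℕ) : 0 < lam n := by
    have := Degenerate.integral_flux_mul_deriv_self_nonneg β (v n)
    rw [energy, if_pos rfl] at this
    exact this.lt_of_ne' (eigen n).1
  have tendsto_atTop : Tendsto lam atTop atTop :=
    (tendsto_norm_cobounded_atTop.comp tendsto).congr fun n => Real.norm_of_nonneg (pos n).le
  exact ⟨inverse.hasDiscreteSpectrum compact (Nat.cofinite_eq_atTop ▸ tendsto) spectrum_eq, lam, v,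
    b, pos, tendsto_atTop, spectrum_eq, hbv,
    fun n => exists_apply_eq_smul_of_mem_eigenspace (eigen n).2, fun n => ⟨hv n, hAv n⟩,
    fun i j => ⟨(hv i).integrableOn_flux_mul_deriv hβ (hv j), energy i j⟩⟩

theorem mainTheorem3 (β : ℝ) (hβ0 : 0 < β) (hβ2 : β < 2) (hβ1 : β ≠ 1) :
    (Degenerate.friedrichs β).HasDiscreteSpectrum ∧
    ∃ (lam : ℕ → ℝ) (v : ℕ → ℝ → ℝ) (b : HilbertBasis ℕ ℝ Degenerate.L2),
      (∀ n, 0 < lam n) ∧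
      Tendsto lam atTop atTop ∧
      (Degenerate.friedrichs β).spectrum = Set.range lam ∧
      (∀ n, b n =ᵐ[volume.restrict (Ioo (0 : ℝ) 1)] v n) ∧
      (∀ n, ∃ h : b n ∈ (Degenerate.friedrichs β).domain, Degenerate.friedrichs β ⟨b n, h⟩ = lam n • b n) ∧
      (∀ n, Degenerate.InDomain β (v n) ∧
        ∀ x ∈ Ioo (0 : ℝ) 1, Degenerate.diffExpr β (v n) x = lam n * v n x) ∧
      (∀ i j,
        IntegrableOn (fun x => x ^ β * deriv (v i) x * deriv (v j) x) (Ioo 0 1) ∧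
        ∫ x in Ioo (0 : ℝ) 1, x ^ β * deriv (v i) x * deriv (v j) x =
          if i = j then lam i else 0) :=
  mainTheorem3_general β hβ2
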